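/- Let $q$ be a prime power, $q'=q^{q-1}$, $A=\mathbb{F}_q[\theta]$, $k=\mathbb{F}_q(\theta)$, $A'=\mathbb{F}_{q'}[\theta]$, $k'=\mathbb{F}_{q'}(\theta)$. Notation. Put $[n]=\theta^{q^n}-\theta$, $D_n=\prod_{i=0}^{n-1}[n-i]^{q^i}$, $L_n=(-1)^n\prod_{i=1}^{n}[i]$ (so $D_0=L_0=1$). If $n=\sum_j\alpha_jq^j$ with $0\le\alpha_j<q$, put $\Gamma_{n+1}=\Pi(n)=\prod_jD_j^{\alpha_j}$. With $G_n(t,y)=\prod_{i=1}^n(t^{q^n}-y^{q^i})$, define $\mathfrak{H}_n(t,y)$ by $$\sum_{n\ge0}\frac{\mathfrak{H}_n(t,y)}{\Gamma_{n+1}|_{\theta=t}}x^n=\Bigl(1-\sum_{i\ge0}\frac{G_i(t,y)}{D_i|_{\theta=t}}x^{q^i}\Bigr)^{-1}\in\mathbb{F}_q(t,y)[[x]];$$ then $H_n(t)=\mathfrak{H}_n(t,\theta)\in A[t]$, and one writes $H_{n-1}(t)=\sum_ju_{n,j}t^j$ with $u_{n,j}\in A$ for $n\ge1$. For $\mathbf{s}=(s_1,\dots,s_r)\in\mathbb{N}_{>0}^r$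 let $\mathfrak{J}_{\mathbf{s}}$ be the set of $\mathbf{j}\in\mathbb{Z}_{\ge0}^r$ with $j_i\le\deg_tH_{s_i-1}$ for all $i$, and $\theta^{\mathbf{j}}=\theta^{j_1+\cdots+j_r}$. Let $$e_C(z)=\sum_{i\ge0}\frac{z^{q^i}}{D_i},\qquad \mathrm{Li}_{\mathbf{s}}(z_1,\dots,z_r)=\sum_{i_1>\cdots>i_r\ge0}\frac{z_1^{q^{i_1}}\cdots z_r^{q^{i_r}}}{L_{i_1}^{s_1}\cdots L_{i_r}^{s_r}}.$$ The Bernoulli--Carlitz numbers $BC_n\in k$ and, for $\boldsymbol{\gamma}\in(\mathbb{F}_{q'}^\times)^r$ and $\mathbf{j}\in\mathfrak{J}_{\mathbf{s}}$, the alternating multiple poly-Bernoulli--Carlitz numbers $BC_n^{\mathbf{s},\boldsymbol{\gamma},\mathbf{j}}\in k'$ are defined by $$\sum_{n\ge0}BC_n\frac{z^n}{\Pi(n)}=\frac{z}{e_C(z)},\qquad \sum_{n\ge0}BC_n^{\mathbf{s},\boldsymbol{\gamma},\mathbf{j}}\frac{z^n}{\Pi(n)}=\frac{\mathrm{Li}_{\mathbf{s}}(e_C(z)\gamma_1u_{s_1,j_1},\gamma_2u_{s_2,j_2},\dots,\gamma_ru_{s_r,j_r})}{e_C(z)}.$$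 For $\mathbf{s}\in\mathbb{Z}^r$, $\boldsymbol{\epsilon}\in(\mathbb{F}_q^\times)^r$ and a monic irreducible $P\in A$, the $P$-component of the alternating finite multiple zeta value is $$\zeta_{\mathcal{A}_k}(\mathbf{s};\boldsymbol{\epsilon})_P=\sum_{\substack{\deg P>\deg a_1>\cdots>\deg a_r\ge0\\ a_i\in A\text{ monic}}}\frac{\epsilon_1^{\deg a_1}\cdots\epsilon_r^{\deg a_r}}{a_1^{s_1}\cdots a_r^{s_r}}\in A/(P).$$ Theorem. Let $r\ge1$, $\mathbf{s}=(s_1,\dots,s_r)\in\mathbb{N}_{>0}^r$ and $\boldsymbol{\epsilon}=(\epsilon_1,\dots,\epsilon_r)\in(\mathbb{F}_q^\times)^r$, and let $\gamma_1,\dots,\gamma_r\in\mathbb{F}_{q'}$ be any elements with $\gamma_i^{q-1}=\epsilon_i$. Let $P\in A$ be any monic irreducible polynomial with $P\nmid\Gamma_{s_i}$ for $1\le i\le r$. 1. In the residue ring $A'/(P)$, $$\zeta_{\mathcal{A}_k}(\mathbf{s};\boldsymbol{\epsilon})_P\equiv\frac{1}{\gamma_1\Gamma_{s_1}\cdots\gamma_r\Gamma_{s_r}}\sum_{\mathbf{j}\in\mathfrak{J}_{\mathbf{s}}}\theta^{\mathbf{j}}\sum_{d=r-1}^{\deg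 P-1}\frac{BC_{q^d-1}^{\mathbf{s},\boldsymbol{\gamma},\mathbf{j}}}{L_d\,BC_{q^d-1}}.$$ 2. For every integer $r'\ge0$, with $\bar{\mathbf{s}}=(1,\dots,1,s_1,\dots,s_r)\in\mathbb{N}_{>0}^{r'+r}$ and $\bar{\boldsymbol{\epsilon}}=(1,\dots,1,\epsilon_1,\dots,\epsilon_r)\in(\mathbb{F}_q^\times)^{r'+r}$, in $A'/(P)$, $$\zeta_{\mathcal{A}_k}(\bar{\mathbf{s}};\bar{\boldsymbol{\epsilon}})_P\equiv\frac{1}{\gamma_1\Gamma_{s_1}\cdots\gamma_r\Gamma_{s_r}}\sum_{\mathbf{j}\in\mathfrak{J}_{\mathbf{s}}}\theta^{\mathbf{j}}\sum_{\deg P>d_0>\cdots>d_{r'}\ge r-1}\frac{BC_{q^{d_{r'}}-1}^{\mathbf{s},\boldsymbol{\gamma},\mathbf{j}}}{L_{d_0}\cdots L_{d_{r'}}\,BC_{q^{d_{r'}}-1}}.$$ Here each congruence means that its right-hand side, an element of $k'$, is a fraction $a/b$ with $a,b\in A'$ and $b$ invertible modulo $P$, and that its class in $A'/(P)$ is the image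 of the left-hand side under $A/(P)\to A'/(P)$. -/

import Mathlib

open Polynomial

noncomputable section

namespace Carlitz

/-! Throughout, `F` is the finite field with `q = Fintype.card F` elements, `A = F[X]` (the variable
`X` is `θ`), and `F'` is a field extension of `F`, with `A' = F'[X]` and `k' = RatFunc F'`. -/

section Basic

variable (F : Type*) [Field F] [Fintype F]

/-- `[n] = θ ^ (q ^ n) - θ`. -/
def bracket (n : ℕ) : F[X] := X ^ (Fintype.card F ^ n) - X

/-- `D_n = [n]^(q^0) [n-1]^(q^1) ⋯ [1]^(q^(n-1))`, with `D_0 = 1`. -/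
def D (n : ℕ) : F[X] := ∏ i ∈ Finset.range n, bracket F (n - i) ^ (Fintype.card F ^ i)

/-- `L_n = (-1)^n [n] [n-1] ⋯ [1]`, with `L_0 = 1`. -/
def L (n : ℕ) : F[X] := (-1) ^ n * ∏ i ∈ Finset.range n, bracket F (i + 1)

/-- The Carlitz factorial `Π(n) = ∏ j, D_j ^ α_j`, where `α_j = n / q ^ j % q` is the `j`-th digit of
`n` in base `q` (which is zero for `j > n`). -/
def factorial (n : ℕ) : F[X] :=
  ∏ j ∈ Finset.range (n + 1), D F j ^ (n / Fintype.card F ^ j % Fintype.card F)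

/-- The Carlitz gamma `Γ_s = Π(s - 1)`, for `s ≥ 1`. -/
def Gamma (s : ℕ) : F[X] := factorial F (s - 1)

end Basic

section AndersonThakur

variable (F : Type*) [Field F] [Fintype F]

/-- The field `F(t, y)`, as `F(t)(y)`. -/
abbrev Fty : Type _ := RatFunc (RatFunc F)

/-- The variable `t` of `F(t, y)`. -/
def varT : Fty F := RatFunc.C RatFunc.X

/-- The variable `y` of `F(t, y)`. -/
def varY : Fty F := RatFunc.X

/-- `G_n(t, y) = ∏_{i=1}^n (t ^ (q ^ n) - y ^ (q ^ i))`. -/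
def G (n : ℕ) : Fty F :=
  ∏ i ∈ Finset.Icc 1 n, (varT F ^ (Fintype.card F ^ n) - varY F ^ (Fintype.card F ^ i))

/-- The power series `∑_{i ≥ 0} (G_i(t, y) / D_i|_{θ = t}) x ^ (q ^ i)`; an `i` with `q ^ i = m`
satisfies `i ≤ m`. -/
def GSeries : PowerSeries (Fty F) :=
  PowerSeries.mk fun m => ∑ i ∈ Finset.range (m + 1),
    if Fintype.card F ^ i = m then G F i / aeval (varT F) (D F i) else 0

/-- The function `𝔥_n(t, y)` with
`∑ n, 𝔥_n(t, y) / Γ_{n+1}|_{θ = t} x ^ n = (1 - ∑ i, (G_i(t, y) / D_i|_{θ = t}) x ^ (q ^ i))⁻¹`. -/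
def frakH (n : ℕ) : Fty F :=
  aeval (varT F) (Gamma F (n + 1)) * PowerSeries.coeff n (1 - GSeries F)⁻¹

/-- The ring homomorphism `A[t] = F[θ][t] → F(t, y)` with `θ ↦ y` and `t ↦ t`. -/
def toFty : F[X][X] →+* Fty F :=
  eval₂RingHom (aeval (R := F) (varY F)).toRingHom (varT F)

variable {F}

set_option linter.unusedSectionVars false

lemma bracket_ne_zero {n : ℕ} (hn : n ≠ 0) : bracket F n ≠ 0 :=
  FiniteField.X_pow_card_pow_sub_X_ne_zero F hn Fintype.one_lt_card

lemma D_ne_zero (n : ℕ) : D F n ≠ 0 := by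
  refine Finset.prod_ne_zero_iff.2 fun i hi => pow_ne_zero _ (bracket_ne_zero ?_)
  have := Finset.mem_range.1 hi
  omega

lemma D_succ (n : ℕ) : D F (n + 1) = bracket F (n + 1) * D F n ^ Fintype.card F := by
  rw [D, Finset.prod_range_succ', D, ← Finset.prod_pow, mul_comm]
  simp [pow_succ, pow_mul]

lemma factorial_eq_prod {n N : ℕ} (h : n < N) :
    factorial F n =
      ∏ j ∈ Finset.range N, D F j ^ (n / Fintype.card F ^ j % Fintype.card F) := by
  refine Finset.prod_subset (fun j hj => ?_) fun j _ hj => ?_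
  · simp only [Finset.mem_range] at *
    omega
  · have h1 : n < j := by simpa using hj
    rw [Nat.div_eq_of_lt (h1.trans (Nat.lt_pow_self Fintype.one_lt_card))]
    simp

lemma digit_add_pow {q m i j : ℕ} (hq : 1 < q) (hi : m / q ^ i % q + 1 < q) :
    (m + q ^ i) / q ^ j % q = m / q ^ j % q + if j = i then 1 else 0 := by
  have hq0 : 0 < q := by omega
  rcases lt_trichotomy j i with h | h | h
  · obtain ⟨c, rfl⟩ := Nat.exists_eq_add_of_lt h
    rw [if_neg (by omega), show q ^ (j + c + 1) = q ^ j * (q * q ^ c) by ring,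
      Nat.add_mul_div_left _ _ (pow_pos hq0 _), Nat.add_mul_mod_self_left, add_zero]
  · subst h
    rw [if_pos rfl, Nat.add_div_right _ (pow_pos hq0 _), Nat.add_mod,
      Nat.mod_eq_of_lt hq, Nat.mod_eq_of_lt hi]
  · obtain ⟨c, rfl⟩ := Nat.exists_eq_add_of_lt h
    rw [if_neg (by omega), add_zero]
    have key : (m / q ^ i + 1) / q = m / q ^ i / q := by
      rw [Nat.succ_div, if_neg, add_zero]
      intro hd
      have := Nat.mod_eq_zero_of_dvd hd
      rw [Nat.add_mod, Nat.mod_eq_of_lt hq, Nat.mod_eq_of_lt hi] at this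
      omega
    rw [show q ^ (i + c + 1) = q ^ i * (q * q ^ c) by ring, ← Nat.div_div_eq_div_mul,
      ← Nat.div_div_eq_div_mul, ← Nat.div_div_eq_div_mul, ← Nat.div_div_eq_div_mul,
      Nat.add_div_right _ (pow_pos hq0 _), key]

lemma factorial_add_pow {m i : ℕ} (hi : m / Fintype.card F ^ i % Fintype.card F + 1 < Fintype.card F) :
    factorial F (m + Fintype.card F ^ i) = factorial F m * D F i := by
  have hq : 1 < Fintype.card F := Fintype.one_lt_card
  have hN : m + Fintype.card F ^ i < m + Fintype.card F ^ i + 1 := by omega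
  rw [factorial_eq_prod hN, factorial_eq_prod (n := m) (N := m + Fintype.card F ^ i + 1) (by omega)]
  simp only [digit_add_pow hq hi, pow_add, Finset.prod_mul_distrib]
  congr 1
  have : i < m + Fintype.card F ^ i + 1 := by
    have := Nat.lt_pow_self (n := i) hq
    omega
  rw [Finset.prod_eq_single i (by intro b _ hb; simp [hb]) (by intro h; simp at h; omega)]
  simp

lemma D_mul_factorial_dvd (m : ℕ) :
    ∀ i, D F i * factorial F m ∣ factorial F (m + Fintype.card F ^ i) := by
  have hq : 1 < Fintype.card F := Fintype.one_lt_card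
  induction m using Nat.strong_induction_on with
  | _ m ih =>
  intro i
  by_cases hi : m / Fintype.card F ^ i % Fintype.card F + 1 < Fintype.card F
  · rw [factorial_add_pow hi, mul_comm]
  · set q := Fintype.card F with hqdef
    have hlt := Nat.mod_lt (m / q ^ i) (show 0 < q by omega)
    have hpos : 0 < q ^ i := pow_pos (by omega) _
    have hdig : m / q ^ i % q = q - 1 := by omega
    have hge : (q - 1) * q ^ i ≤ m := by
      calc (q - 1) * q ^ i ≤ (m / q ^ i) * q ^ i :=
            Nat.mul_le_mul_right _ (hdig ▸ Nat.mod_le _ _)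
        _ ≤ m := Nat.div_mul_le_self _ _
    -- removing the digit `q - 1` at place `i`
    have step : ∀ e, e ≤ q - 1 → factorial F (m - (q - 1) * q ^ i + e * q ^ i)
        = factorial F (m - (q - 1) * q ^ i) * D F i ^ e := by
      have hbase : (m - (q - 1) * q ^ i) / q ^ i % q = 0 := by
        rw [mul_comm, Nat.sub_mul_div, ← Nat.mod_add_div (m / q ^ i) q, hdig]
        simp
      intro e
      induction e with
      | zero => intro _; simp
      | succ e ihe =>
        intro he
        rw [add_mul, one_mul, ← add_assoc, hqdef, factorial_add_pow, ← hqdef, ihe (by omega),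
          pow_succ, mul_assoc]
        rw [← hqdef, Nat.add_mul_div_right _ _ hpos, Nat.add_mod, hbase, Nat.zero_add,
          Nat.mod_mod, Nat.mod_eq_of_lt (by omega)]
        omega
    have h1 := step (q - 1) le_rfl
    rw [Nat.sub_add_cancel hge] at h1
    have h2 := ih (m - (q - 1) * q ^ i)
      (Nat.sub_lt (lt_of_lt_of_le (Nat.mul_pos (by omega) hpos) hge)
        (Nat.mul_pos (by omega) hpos)) (i + 1)
    have h3 : m - (q - 1) * q ^ i + q ^ (i + 1) = m + q ^ i := by
      have : q ^ (i + 1) = (q - 1) * q ^ i + q ^ i := by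
        rw [pow_succ, ← Nat.succ_mul, Nat.succ_eq_add_one, Nat.sub_add_cancel (by omega), mul_comm]
      omega
    rw [h3] at h2
    refine dvd_trans ?_ h2
    rw [h1, D_succ, ← hqdef]
    refine ⟨bracket F (i + 1), ?_⟩
    have : D F i ^ q = D F i ^ (q - 1) * D F i := by
      rw [← pow_succ, Nat.sub_add_cancel (by omega)]
    rw [this]
    ring

lemma aeval_varT (p : F[X]) :
    aeval (varT F) p = RatFunc.C (algebraMap F[X] (RatFunc F) p) := by
  induction p using Polynomial.induction_on' with
  | add p q hp hq => simp [hp, hq]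
  | monomial n a =>
    have h : algebraMap F (Fty F) a = RatFunc.C (RatFunc.C a) := by
      rw [IsScalarTower.algebraMap_apply F (RatFunc F) (Fty F), RatFunc.algebraMap_eq_C,
        RatFunc.algebraMap_eq_C]
    simp [← Polynomial.C_mul_X_pow_eq_monomial, varT, h]

lemma toFty_C (p : F[X]) : toFty F (C p) = aeval (varY F) p := by
  simp [toFty]

lemma toFty_map_C (p : F[X]) : toFty F (p.map C) = aeval (varT F) p := by
  simp only [toFty, coe_eval₂RingHom, eval₂_map, aeval_def]
  congr 1
  ext a
  simp

lemma constantCoeff_GSeries : PowerSeries.constantCoeff (GSeries F) = 0 := by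
  rw [← PowerSeries.coeff_zero_eq_constantCoeff_apply]
  simp [GSeries]

/-- `𝔥_n(t, θ)` is a polynomial in `t` with coefficients in `A`. -/
lemma frakH_mem_range (n : ℕ) : ∃ H : F[X][X], toFty F H = frakH F n := by
  suffices h : frakH F n ∈ (toFty F).range by simpa using h
  induction n using Nat.strong_induction_on with
  | _ n ih =>
  have hS : (1 - GSeries F) * (1 - GSeries F)⁻¹ = 1 :=
    PowerSeries.mul_inv_cancel _ (by simp [constantCoeff_GSeries])
  have hT : (1 - GSeries F)⁻¹ = 1 + GSeries F * (1 - GSeries F)⁻¹ := by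
    linear_combination hS
  have hGam : ∀ p : F[X], aeval (varT F) p ∈ (toFty F).range := fun p =>
    ⟨p.map C, toFty_map_C p⟩
  have hvT : varT F ∈ (toFty F).range := by simpa using hGam X
  have hvY : varY F ∈ (toFty F).range := ⟨C X, by simp [toFty_C]⟩
  have hG : ∀ i, G F i ∈ (toFty F).range := fun i =>
    Subring.prod_mem _ fun j _ => Subring.sub_mem _ (Subring.pow_mem _ hvT _)
      (Subring.pow_mem _ hvY _)
  rw [frakH, hT, map_add, mul_add, PowerSeries.coeff_mul]
  refine Subring.add_mem _ (Subring.mul_mem _ (hGam _) ?_) ?_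
  · rw [PowerSeries.coeff_one]
    split_ifs
    exacts [Subring.one_mem _, Subring.zero_mem _]
  · rw [Finset.mul_sum]
    refine Subring.sum_mem _ fun ab hab => ?_
    obtain ⟨a, b⟩ := ab
    have hab' : a + b = n := by simpa using hab
    simp only [GSeries, PowerSeries.coeff_mk, Finset.sum_mul, Finset.mul_sum]
    refine Subring.sum_mem _ fun i _ => ?_
    split_ifs with hi
    · have hpos : 0 < Fintype.card F ^ i := pow_pos Fintype.card_pos _
      obtain ⟨c, hc⟩ := D_mul_factorial_dvd (F := F) b i
      have hn : n = b + Fintype.card F ^ i := by omega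
      have hD : aeval (varT F) (D F i) ≠ 0 := by
        rw [aeval_varT]
        simpa using D_ne_zero i
      have e : aeval (varT F) (Gamma F (n + 1)) *
          (G F i / aeval (varT F) (D F i) * PowerSeries.coeff b (1 - GSeries F)⁻¹)
          = aeval (varT F) c * G F i * frakH F b := by
        rw [frakH, Gamma, Gamma, Nat.add_sub_cancel, Nat.add_sub_cancel, hn, hc, map_mul, map_mul]
        field_simp
      rw [GSeries] at e
      rw [e]
      exact Subring.mul_mem _ (Subring.mul_mem _ (hGam _) (hG _)) (ih b (by omega))
    · simp

variable (F)

/-- The Anderson–Thakur polynomial `H_n(t) = 𝔥_n(t, θ) ∈ A[t]`. -/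
def H (n : ℕ) : F[X][X] := (frakH_mem_range (F := F) n).choose

/-- The coefficients `u_{s, j} ∈ A` of `H_{s-1}(t) = ∑ j, u_{s, j} t ^ j`, for `s ≥ 1`. -/
def u (s j : ℕ) : F[X] := (H F (s - 1)).coeff j

/-- The set `𝔍_s` of the `j ∈ ℕ^r` with `j_i ≤ deg_t H_{s_i - 1}` for all `i`. -/
def J {r : ℕ} (s : Fin r → ℕ) : Finset (Fin r → ℕ) :=
  Fintype.piFinset fun i => Finset.range ((H F (s i - 1)).natDegree + 1)

end AndersonThakur

section BernoulliCarlitz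

variable (F F' : Type*) [Field F] [Fintype F] [Field F'] [Algebra F F']

/-- The inclusion `A → k'`. -/
def incl : F[X] →+* RatFunc F' :=
  (algebraMap F'[X] (RatFunc F')).comp (mapRingHom (algebraMap F F'))

/-- The Carlitz exponential `e_C(z) = ∑_{i ≥ 0} z ^ (q ^ i) / D_i`, as a power series over `k'`; an
`i` with `q ^ i = m` satisfies `i ≤ m`. -/
def expC : PowerSeries (RatFunc F') :=
  PowerSeries.mk fun m => ∑ i ∈ Finset.range (m + 1),
    if Fintype.card F ^ i = m then (incl F F' (D F i))⁻¹ else 0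

/-- The Carlitz multiple polylogarithm
`Li_s(f_1, …, f_r) = ∑_{d_1 > ⋯ > d_r ≥ 0} f_1 ^ (q ^ d_1) ⋯ f_r ^ (q ^ d_r) / (L_{d_1} ^ s_1 ⋯ L_{d_r} ^ s_r)`
at power series `f_1, …, f_r` in `z`, where `f_1` has no constant term. The sum is the formal one, taken
coefficient by coefficient: a given power of `z` occurs in only finitely many of its terms. -/
def Li {r : ℕ} (s : Fin r → ℕ) (f : Fin r → PowerSeries (RatFunc F')) :
    PowerSeries (RatFunc F') :=
  PowerSeries.mk fun n => ∑ᶠ d : {d : Fin r → ℕ // StrictAnti d},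
    PowerSeries.coeff n
      (∏ i, f i ^ (Fintype.card F ^ d.1 i) * PowerSeries.C ((incl F F' (L F (d.1 i)) ^ s i)⁻¹))

/-- The Bernoulli–Carlitz numbers: `∑ n, BC_n z ^ n / Π(n) = z / e_C(z)`. -/
def BC (n : ℕ) : RatFunc F' :=
  incl F F' (factorial F n) *
    HahnSeries.coeff
      (((PowerSeries.X : PowerSeries (RatFunc F')) : LaurentSeries (RatFunc F')) /
        ((expC F F' : PowerSeries (RatFunc F')) : LaurentSeries (RatFunc F'))) (n : ℤ)

variable {F'}

/-- The alternating multiple poly-Bernoulli–Carlitz numbers: `∑ n, BC_n^{s,γ,j} z ^ n / Π(n)` is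
`Li_s(e_C(z) γ_1 u_{s_1,j_1}, γ_2 u_{s_2,j_2}, …, γ_r u_{s_r,j_r}) / e_C(z)`. -/
def altBC {r : ℕ} (s : Fin r → ℕ) (γ : Fin r → F') (j : Fin r → ℕ) (n : ℕ) : RatFunc F' :=
  incl F F' (factorial F n) *
    HahnSeries.coeff
      (((Li F F' s fun i =>
            (if i.val = 0 then expC F F' else 1) *
              PowerSeries.C (RatFunc.C (γ i) * incl F F' (u F (s i) (j i))) :
          PowerSeries (RatFunc F')) : LaurentSeries (RatFunc F')) /
        ((expC F F' : PowerSeries (RatFunc F')) : LaurentSeries (RatFunc F'))) (n : ℤ)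

end BernoulliCarlitz

section FiniteMZV

variable {F : Type*} [Field F] [Fintype F]

/-- The index set of the finite multiple zeta values: tuples `(a_1, …, a_r)` of monic polynomials with
`N > deg a_1 > ⋯ > deg a_r ≥ 0`. -/
def indexSet (F : Type*) [Field F] (r N : ℕ) : Set (Fin r → F[X]) :=
  {a | (∀ i, (a i).Monic) ∧ (∀ i, (a i).natDegree < N) ∧ StrictAnti fun i => (a i).natDegree}

lemma indexSet_finite (r N : ℕ) : (indexSet F r N).Finite := by
  have h : {p : F[X] | p.natDegree < N}.Finite := by
    refine Set.Finite.subset (s := Set.range fun c : Fin N → F => ∑ i, C (c i) * X ^ i.val)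
      (Set.finite_range _) fun p hp => ⟨fun i => p.coeff i, ?_⟩
    change ∑ i : Fin N, C (p.coeff i) * X ^ i.val = p
    rw [Fin.sum_univ_eq_sum_range (fun i => C (p.coeff i) * X ^ i) N]
    exact (p.as_sum_range_C_mul_X_pow' hp).symm
  exact (Set.Finite.pi' fun _ : Fin r => h).subset fun a ha i => ha.2.1 i

/-- The component at `P` of the alternating finite multiple zeta value,
`ζ(s; ε)_P = ∑ ε_1 ^ deg a_1 ⋯ ε_r ^ deg a_r / (a_1 ^ s_1 ⋯ a_r ^ s_r) ∈ A/(P)`, where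
`deg P > deg a_1 > ⋯ > deg a_r ≥ 0` and the `a_i` are monic. -/
def altFMZV {r : ℕ} (s : Fin r → ℤ) (ε : Fin r → Fˣ) (P : F[X]) [Fact (Irreducible P)] :
    AdjoinRoot P :=
  ∑ a ∈ (indexSet_finite (F := F) r P.natDegree).toFinset,
    ∏ i, AdjoinRoot.mk P (C (ε i : F)) ^ (a i).natDegree / AdjoinRoot.mk P (a i) ^ s i

/-- `x ≡ c` in `A'/(Q)`: the element `x` of `k'` is a fraction `a / b` whose denominator is invertible
modulo `Q`, and its class modulo `Q` is `c`. -/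
def ReducesTo {F' : Type*} [Field F'] (Q : F'[X]) (x : RatFunc F') (c : AdjoinRoot Q) : Prop :=
  ∃ a b : F'[X], IsUnit (AdjoinRoot.mk Q b) ∧
    x = algebraMap F'[X] (RatFunc F') a / algebraMap F'[X] (RatFunc F') b ∧
    AdjoinRoot.mk Q a = AdjoinRoot.mk Q b * c

/-- The map `A/(P) → A'/(P)` induced by the inclusion `A → A'`. -/
def residueMap {F : Type*} (F' : Type*) [Field F] [Field F'] [Algebra F F'] (P : F[X]) :
    AdjoinRoot P →+* AdjoinRoot (P.map (algebraMap F F')) :=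
  AdjoinRoot.map (algebraMap F F') P (P.map (algebraMap F F')) dvd_rfl

end FiniteMZV

end Carlitz

end

open Polynomial

noncomputable section

/-! Both congruences come from equalities in `k'`. Write S_d(s) for the sum of 1/a^s over the monic
a of degree d. The right-hand side of part 1 equals the sum of ∏ ε_i^{d_i} S_{d_i}(s_i) over deg P >
d_1 > ⋯ > d_r ≥ 0. Every a that occurs has degree below deg P, hence is a unit modulo P, and the
reduction is done term by term (`reducesTo_sum_zetaTerm`).

The Carlitz logarithm inverts e_C, so z = ∑ e_C^{q^i} / L_i and z / e_C is a combination of the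
powers e_C^{q^i - 1}. The series defining the poly-Bernoulli–Carlitz numbers is likewise a
combination of the e_C^{q^{d_1} - 1}. The coefficient of z^{q^d - 1} in e_C^{q^m - 1} is 1 if m = d
and 0 otherwise (`coeff_pow_sub_one`). Hence BC_{q^d - 1} = Π(q^d - 1) / L_d, and the quotient by
L_d BC_{q^d - 1} in the theorem is exactly the part d_1 = d of the polylogarithm, with e_C removed
(`altBC_div`).

The sum over j is then evaluated by the Anderson–Thakur formula ∑_j u_{s,j}^{q^d} θ^j = Γ_s L_d^s
S_d(s) (`sum_u_pow`), together with γ^{q^d} = γ ε^d (`pow_card_pow_eq`). To prove that formula, ∏ (X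
- a) over the monic a of degree d is identified with E_d - D_d for an explicit 𝔽_q-linear polynomial
E_d (`prod_monics`). Its logarithmic derivative gives the generating series of the S_d(n), and this
series satisfies the recursion of H_n after θ ↦ θ^{q^d}, t ↦ θ.

Part 2 needs in addition only S_d(1) = 1 / L_d (`powerSum_one`): each 1 put in front of the index
contributes a factor 1 / L. -/

namespace Carlitz

/-! ### Additivity of the q^i-power map -/

section Frobenius

variable {F : Type*} [Field F] [Fintype F] {R : Type*} [CommRing R]

/-- The `q ^ i`-power map of a commutative ring over the field with `q` elements. -/
def powCard (f : F →+* R) (i : ℕ) : R →+* R :=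
  letI := f.toAlgebra
  ((FiniteField.frobeniusAlgHom F R : R →ₐ[F] R) ^ i : R →ₐ[F] R).toRingHom

lemma powCard_apply (f : F →+* R) (i : ℕ) (x : R) :
    powCard f i x = x ^ Fintype.card F ^ i := by
  let := f.toAlgebra
  change ((FiniteField.frobeniusAlgHom F R : R →ₐ[F] R) ^ i) x = _
  induction i with
  | zero => simp
  | succ i ih =>
    rw [pow_succ', AlgHom.mul_apply, ih, FiniteField.coe_frobeniusAlgHom, pow_succ, pow_mul]

lemma add_pow_card_pow (f : F →+* R) (i : ℕ) (x y : R) :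
    (x + y) ^ Fintype.card F ^ i = x ^ Fintype.card F ^ i + y ^ Fintype.card F ^ i := by
  simpa only [powCard_apply] using map_add (powCard f i) x y

lemma sub_pow_card_pow (f : F →+* R) (i : ℕ) (x y : R) :
    (x - y) ^ Fintype.card F ^ i = x ^ Fintype.card F ^ i - y ^ Fintype.card F ^ i := by
  simpa only [powCard_apply] using map_sub (powCard f i) x y

lemma neg_pow_card_pow (f : F →+* R) (i : ℕ) (x : R) :
    (-x) ^ Fintype.card F ^ i = -x ^ Fintype.card F ^ i := by
  simpa only [powCard_apply] using map_neg (powCard f i) x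

lemma sum_pow_card_pow (f : F →+* R) (i : ℕ) {ι : Type*} (s : Finset ι) (g : ι → R) :
    (∑ a ∈ s, g a) ^ Fintype.card F ^ i = ∑ a ∈ s, g a ^ Fintype.card F ^ i := by
  simpa only [powCard_apply] using map_sum (powCard f i) g s

end Frobenius

/-! ### Carlitz exponential and logarithm are mutually inverse, on coefficients -/

section ExpLog

variable {F : Type*} [Field F] [Fintype F]

lemma L_ne_zero (n : ℕ) : L F n ≠ 0 :=
  mul_ne_zero (pow_ne_zero _ (neg_ne_zero.2 one_ne_zero))
    (Finset.prod_ne_zero_iff.2 fun i _ => bracket_ne_zero (by omega))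

lemma D_zero : D F 0 = 1 := by simp [D]

lemma L_zero : L F 0 = 1 := by simp [L]

lemma L_succ (n : ℕ) : L F (n + 1) = -(bracket F (n + 1) * L F n) := by
  rw [L, L, Finset.prod_range_succ]
  ring

lemma bracket_zero : bracket F 0 = 0 := by simp [bracket]

lemma bracket_pow (n i : ℕ) :
    bracket F n ^ Fintype.card F ^ i = X ^ Fintype.card F ^ (n + i) - X ^ Fintype.card F ^ i := by
  rw [bracket, sub_pow_card_pow (C : F →+* F[X]), ← pow_mul, ← pow_add]

lemma bracket_add (n i : ℕ) :
    bracket F (n + i) = bracket F n ^ Fintype.card F ^ i + bracket F i := by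
  rw [bracket_pow, bracket, bracket]
  ring

variable {K : Type*} [Field K] {φ : F[X] →+* K}

lemma bracket_mul_inv_D (hφ : Function.Injective φ) (n : ℕ) :
    φ (bracket F (n + 1)) * (φ (D F (n + 1)))⁻¹ = ((φ (D F n))⁻¹) ^ Fintype.card F := by
  have h : φ (bracket F (n + 1)) ≠ 0 := (map_ne_zero_iff φ hφ).2 (bracket_ne_zero (by omega))
  rw [D_succ, map_mul, map_pow, mul_inv, mul_inv_cancel_left₀ h, inv_pow]

lemma bracket_mul_inv_L (hφ : Function.Injective φ) (n : ℕ) :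
    φ (bracket F (n + 1)) * (φ (L F (n + 1)))⁻¹ = -(φ (L F n))⁻¹ := by
  have h : φ (bracket F (n + 1)) ≠ 0 := (map_ne_zero_iff φ hφ).2 (bracket_ne_zero (by omega))
  rw [L_succ, map_neg, map_mul, inv_neg, mul_inv, mul_neg, mul_inv_cancel_left₀ h]

/-- This is log_C(e_C(z)) = z in degree q^(n+1). After multiplication by [n+1] = [n+1-i]^(q^i) +
[i], the relations for [i]/L_i and [m]/D_m turn the two resulting sums into negatives of each other.
-/
lemma sum_inv_L_mul_inv_D (hφ : Function.Injective φ) (n : ℕ) :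
    ∑ i ∈ Finset.range (n + 2),
      (φ (L F i))⁻¹ * ((φ (D F (n + 1 - i)))⁻¹) ^ Fintype.card F ^ i = 0 := by
  have hb : φ (bracket F (n + 1)) ≠ 0 := (map_ne_zero_iff φ hφ).2 (bracket_ne_zero (by omega))
  refine (mul_eq_zero.1 ?_).resolve_left hb
  have key : ∀ i ∈ Finset.range (n + 2),
      φ (bracket F (n + 1)) * ((φ (L F i))⁻¹ * ((φ (D F (n + 1 - i)))⁻¹) ^ Fintype.card F ^ i)
      = φ (bracket F i) * (φ (L F i))⁻¹ * ((φ (D F (n + 1 - i)))⁻¹) ^ Fintype.card F ^ i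
        + (φ (L F i))⁻¹ *
          (φ (bracket F (n + 1 - i)) * (φ (D F (n + 1 - i)))⁻¹) ^ Fintype.card F ^ i := by
    intro i hi
    have hi' : n + 1 = n + 1 - i + i := by have := Finset.mem_range.1 hi; omega
    conv_lhs => rw [hi', bracket_add, ← hi']
    rw [map_add, map_pow, mul_pow]
    ring
  rw [Finset.mul_sum, Finset.sum_congr rfl key, Finset.sum_add_distrib, Finset.sum_range_succ',
    Finset.sum_range_succ _ (n + 1), bracket_zero]
  simp only [bracket_mul_inv_L hφ, Nat.sub_self, bracket_zero, map_zero, zero_mul, add_zero]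
  rw [zero_pow (pow_ne_zero _ Fintype.card_ne_zero), mul_zero, add_zero, ← Finset.sum_add_distrib]
  refine Finset.sum_eq_zero fun i hi => ?_
  have hi' : n + 1 - i = n - i + 1 := by have := Finset.mem_range.1 hi; omega
  rw [hi', bracket_mul_inv_D hφ, ← pow_mul, ← pow_succ', Nat.add_sub_add_right]
  ring

/-- This is e_C(log_C(z)) = z. Multiplication by [n+1] now gives S^q - S, where S is the same sum
with n in place of n+1, so induction applies. -/
lemma sum_inv_D_mul_inv_L (hφ : Function.Injective φ) (n : ℕ) :
    ∑ i ∈ Finset.range (n + 2),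
      (φ (D F i))⁻¹ * ((φ (L F (n + 1 - i)))⁻¹) ^ Fintype.card F ^ i = 0 := by
  have f : F →+* K := φ.comp C
  have hb : φ (bracket F (n + 1)) ≠ 0 := (map_ne_zero_iff φ hφ).2 (bracket_ne_zero (by omega))
  refine (mul_eq_zero.1 ?_).resolve_left hb
  have key : ∀ i ∈ Finset.range (n + 2),
      φ (bracket F (n + 1)) * ((φ (D F i))⁻¹ * ((φ (L F (n + 1 - i)))⁻¹) ^ Fintype.card F ^ i)
      = φ (bracket F i) * (φ (D F i))⁻¹ * ((φ (L F (n + 1 - i)))⁻¹) ^ Fintype.card F ^ i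
        + (φ (D F i))⁻¹ *
          (φ (bracket F (n + 1 - i)) * (φ (L F (n + 1 - i)))⁻¹) ^ Fintype.card F ^ i := by
    intro i hi
    have hi' : n + 1 = n + 1 - i + i := by have := Finset.mem_range.1 hi; omega
    conv_lhs => rw [hi', bracket_add, ← hi']
    rw [map_add, map_pow, mul_pow]
    ring
  have key2 : ∑ i ∈ Finset.range (n + 2), φ (bracket F (n + 1)) *
      ((φ (D F i))⁻¹ * ((φ (L F (n + 1 - i)))⁻¹) ^ Fintype.card F ^ i)
      = (∑ i ∈ Finset.range (n + 1),
          (φ (D F i))⁻¹ * ((φ (L F (n - i)))⁻¹) ^ Fintype.card F ^ i) ^ Fintype.card F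
        - ∑ i ∈ Finset.range (n + 1),
          (φ (D F i))⁻¹ * ((φ (L F (n - i)))⁻¹) ^ Fintype.card F ^ i := by
    have hs := sum_pow_card_pow f 1 (Finset.range (n + 1)) fun i =>
          (φ (D F i))⁻¹ * ((φ (L F (n - i)))⁻¹) ^ Fintype.card F ^ i
    rw [pow_one] at hs
    rw [hs, Finset.sum_congr rfl key, Finset.sum_add_distrib, Finset.sum_range_succ',
      Finset.sum_range_succ _ (n + 1), bracket_zero]
    simp only [bracket_mul_inv_D hφ, Nat.sub_self, bracket_zero, map_zero, zero_mul, add_zero]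
    rw [zero_pow (pow_ne_zero _ Fintype.card_ne_zero), mul_zero, add_zero, sub_eq_add_neg,
      ← Finset.sum_neg_distrib]
    congr 1
    · refine Finset.sum_congr rfl fun i _ => ?_
      rw [mul_pow, ← pow_mul, ← pow_succ, Nat.add_sub_add_right]
    · refine Finset.sum_congr rfl fun i hi => ?_
      have hi' : n + 1 - i = n - i + 1 := by have := Finset.mem_range.1 hi; omega
      rw [hi', bracket_mul_inv_L hφ, neg_pow_card_pow f, mul_neg]
  rw [Finset.mul_sum, key2]
  -- For n = 0 the sum S is 1, which also satisfies S^q = S; afterwards S = 0 by induction.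
  cases n with
  | zero => simp [D_zero, L_zero]
  | succ n => rw [sum_inv_D_mul_inv_L hφ n, zero_pow Fintype.card_ne_zero, sub_zero]

end ExpLog

/-! ### The polynomial vanishing on the elements of A of degree less than d -/

section CarlitzPolynomial

variable {F : Type*} [Field F] [Fintype F] {K : Type*} [Field K] (φ : F[X] →+* K)

/-- The polynomial `∑ i ≤ d, D_d / (D_i L_{d-i} ^ (q ^ i)) z ^ (q ^ i)`, whose roots are the
polynomials in `θ` of degree less than `d`. -/
def carlitzPoly (d : ℕ) : K[X] :=
  ∑ i ∈ Finset.range (d + 1),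
    C (φ (D F d) * ((φ (D F i))⁻¹ * (φ (L F (d - i)))⁻¹ ^ Fintype.card F ^ i)) *
      X ^ Fintype.card F ^ i

lemma eval_carlitzPoly (d : ℕ) (x : K) :
    (carlitzPoly φ d).eval x = ∑ i ∈ Finset.range (d + 1),
      φ (D F d) * ((φ (D F i))⁻¹ * (φ (L F (d - i)))⁻¹ ^ Fintype.card F ^ i) *
        x ^ Fintype.card F ^ i := by
  simp [carlitzPoly, eval_finsetSum]

lemma eval_carlitzPoly_add (d : ℕ) (x y : K) :
    (carlitzPoly φ d).eval (x + y) = (carlitzPoly φ d).eval x + (carlitzPoly φ d).eval y := by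
  simp only [eval_carlitzPoly, add_pow_card_pow (φ.comp C), mul_add, Finset.sum_add_distrib]

lemma eval_carlitzPoly_C_mul (d : ℕ) (c : F) (x : K) :
    (carlitzPoly φ d).eval (φ (C c) * x) = φ (C c) * (carlitzPoly φ d).eval x := by
  simp only [eval_carlitzPoly, Finset.mul_sum, mul_pow, ← map_pow, FiniteField.pow_card_pow]
  exact Finset.sum_congr rfl fun i _ => by ring

variable {φ}

/-- Passing from θ E(x) to E(θx) changes the coefficient of x^(q^i) by the factor [i], which kills i
= 0; then [i]/D_i = D_(i-1)^(-q) and D_(d+1) = [d+1] D_d^q give a q-th power of E_d. -/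
lemma eval_carlitzPoly_X_mul (hφ : Function.Injective φ) (d : ℕ) (x : K) :
    (carlitzPoly φ (d + 1)).eval (φ X * x) = φ X * (carlitzPoly φ (d + 1)).eval x +
      φ (bracket F (d + 1)) * (carlitzPoly φ d).eval x ^ Fintype.card F := by
  have hs := sum_pow_card_pow (φ.comp C) 1 (Finset.range (d + 1)) fun i =>
      φ (D F d) * ((φ (D F i))⁻¹ * (φ (L F (d - i)))⁻¹ ^ Fintype.card F ^ i) *
        x ^ Fintype.card F ^ i
  rw [pow_one] at hs
  rw [← sub_eq_iff_eq_add', eval_carlitzPoly, eval_carlitzPoly, eval_carlitzPoly, hs,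
    Finset.mul_sum, ← Finset.sum_sub_distrib, Finset.sum_range_succ', Finset.mul_sum]
  simp only [pow_zero, pow_one]
  rw [mul_left_comm, sub_self, add_zero]
  refine Finset.sum_congr rfl fun i _ => ?_
  have hb : φ X ^ Fintype.card F ^ (i + 1) = φ (bracket F (i + 1)) + φ X := by
    simp [bracket]
  rw [mul_pow, hb]
  calc _ = φ (D F (d + 1)) * ((φ (bracket F (i + 1)) * (φ (D F (i + 1)))⁻¹) *
        (φ (L F (d + 1 - (i + 1))))⁻¹ ^ Fintype.card F ^ (i + 1)) *
        x ^ Fintype.card F ^ (i + 1) := by ring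
    _ = _ := by
      rw [bracket_mul_inv_D hφ, D_succ, map_mul, map_pow, Nat.add_sub_add_right, mul_pow, mul_pow,
        mul_pow, ← pow_mul, ← pow_mul, ← pow_succ, mul_assoc, mul_assoc, mul_assoc, mul_assoc,
        mul_assoc]

lemma eval_carlitzPoly_one (hφ : Function.Injective φ) (d : ℕ) :
    (carlitzPoly φ (d + 1)).eval 1 = 0 := by
  rw [eval_carlitzPoly]
  simp only [one_pow, mul_one, ← Finset.mul_sum]
  rw [sum_inv_D_mul_inv_L hφ, mul_zero]

lemma eval_carlitzPoly_X_pow_of_lt (hφ : Function.Injective φ) {n d : ℕ} (h : n < d) :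
    (carlitzPoly φ d).eval (φ (X ^ n)) = 0 := by
  induction n generalizing d with
  | zero =>
    obtain ⟨d, rfl⟩ : ∃ e, d = e + 1 := ⟨d - 1, by omega⟩
    simpa using eval_carlitzPoly_one hφ d
  | succ n ih =>
    obtain ⟨d, rfl⟩ : ∃ e, d = e + 1 := ⟨d - 1, by omega⟩
    rw [pow_succ', map_mul, eval_carlitzPoly_X_mul hφ, ih (by omega), ih (by omega),
      zero_pow Fintype.card_ne_zero, mul_zero, mul_zero, add_zero]

lemma eval_carlitzPoly_X_pow (hφ : Function.Injective φ) (d : ℕ) :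
    (carlitzPoly φ d).eval (φ (X ^ d)) = φ (D F d) := by
  induction d with
  | zero => simp [eval_carlitzPoly, D_zero, L_zero]
  | succ d ih =>
    rw [pow_succ', map_mul, eval_carlitzPoly_X_mul hφ, ih,
      eval_carlitzPoly_X_pow_of_lt hφ (Nat.lt_succ_self d), mul_zero, zero_add, D_succ, map_mul,
      map_pow]

/-- By linearity over `F`, only the leading term θ^d contributes, all lower powers of θ being roots.
-/
lemma eval_carlitzPoly_of_monic (hφ : Function.Injective φ) {a : F[X]} (ha : a.Monic) :
    (carlitzPoly φ a.natDegree).eval (φ a) = φ (D F a.natDegree) := by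
  let E : K →+ K := AddMonoidHom.mk' (fun x => (carlitzPoly φ a.natDegree).eval x)
    (eval_carlitzPoly_add φ a.natDegree)
  have h : E (φ a) = φ (D F a.natDegree) := by
    conv_lhs => rw [ha.as_sum, map_add, map_sum, map_add, map_sum]
    rw [Finset.sum_eq_zero, add_zero]
    · exact eval_carlitzPoly_X_pow hφ _
    · intro i hi
      change (carlitzPoly φ a.natDegree).eval (φ _) = 0
      rw [map_mul, eval_carlitzPoly_C_mul,
        eval_carlitzPoly_X_pow_of_lt hφ (Finset.mem_range.1 hi), mul_zero]
  exact h

variable (F) in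
lemma finite_monic (d : ℕ) : {a : F[X] | a.Monic ∧ a.natDegree = d}.Finite := by
  have : Finite (degreeLT F d) := Finite.of_equiv _ (degreeLTEquiv F d).symm.toEquiv
  exact Finite.of_equiv _ (monicEquivDegreeLT (R := F) d).symm

variable (F) in
/-- The monic polynomials of degree `d`. -/
def monics (d : ℕ) : Finset F[X] := (finite_monic F d).toFinset

lemma mem_monics {d : ℕ} {a : F[X]} : a ∈ monics F d ↔ a.Monic ∧ a.natDegree = d := by
  simp [monics]

lemma card_monics (d : ℕ) : (monics F d).card = Fintype.card F ^ d := by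
  rw [monics, ← Set.ncard_eq_toFinset_card _ (finite_monic F d), ← Nat.card_coe_set_eq]
  refine (Nat.card_congr ((monicEquivDegreeLT (R := F) d).trans
    (degreeLTEquiv F d).toEquiv)).trans ?_
  simp

lemma carlitzPoly_eq_add (hφ : Function.Injective φ) (d : ℕ) :
    ∃ R : K[X], R.degree < (Fintype.card F ^ d : ℕ) ∧
      carlitzPoly φ d = X ^ Fintype.card F ^ d + R := by
  refine ⟨∑ i ∈ Finset.range d,
    C (φ (D F d) * ((φ (D F i))⁻¹ * (φ (L F (d - i)))⁻¹ ^ Fintype.card F ^ i)) *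
      X ^ Fintype.card F ^ i, ?_, ?_⟩
  · refine (degree_sum_le _ _).trans_lt ((Finset.sup_lt_iff (WithBot.bot_lt_coe _)).2 ?_)
    intro i hi
    refine (degree_C_mul_X_pow_le _ _).trans_lt ?_
    exact_mod_cast Nat.pow_lt_pow_right Fintype.one_lt_card (Finset.mem_range.1 hi)
  · have h : φ (D F d) ≠ 0 := (map_ne_zero_iff φ hφ).2 (D_ne_zero d)
    rw [carlitzPoly, Finset.sum_range_succ, add_comm]
    simp [L_zero, h]

/-- Both sides are monic of degree q^d, and each of the q^d distinct values `φ a` is a root of the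
right-hand side. -/
lemma prod_monics (hφ : Function.Injective φ) (d : ℕ) :
    ∏ a ∈ monics F d, (X - C (φ a)) = carlitzPoly φ d - C (φ (D F d)) := by
  obtain ⟨R, hR, h⟩ := carlitzPoly_eq_add hφ d
  have hq : 0 < Fintype.card F ^ d := pow_pos Fintype.card_pos _
  have hform : carlitzPoly φ d - C (φ (D F d)) =
      X ^ Fintype.card F ^ d + (R - C (φ (D F d))) := by rw [h]; ring
  have hlt : (R - C (φ (D F d))).degree < (Fintype.card F ^ d : ℕ) :=
    (degree_sub_le _ _).trans_lt (max_lt hR (degree_C_le.trans_lt (by exact_mod_cast hq)))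
  have hmon : (carlitzPoly φ d - C (φ (D F d))).Monic := by
    rw [hform]
    exact monic_X_pow_add hlt
  have hdeg : (carlitzPoly φ d - C (φ (D F d))).natDegree = Fintype.card F ^ d := by
    refine natDegree_eq_of_degree_eq_some ?_
    rw [hform, degree_add_eq_left_of_degree_lt (by rwa [degree_X_pow]), degree_X_pow]
  have hmon' : (∏ a ∈ monics F d, (X - C (φ a))).Monic := monic_prod_X_sub_C _ _
  refine (eq_of_dvd_of_natDegree_le_of_leadingCoeff ?_ ?_ ?_)
  · refine Finset.prod_dvd_of_coprime ?_ ?_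
    · intro a _ b _ hab
      exact isCoprime_X_sub_C_of_isUnit_sub (sub_ne_zero.2 (hφ.ne hab)).isUnit
    · intro a ha
      obtain ⟨hm, rfl⟩ := mem_monics.1 ha
      rw [dvd_iff_isRoot, IsRoot, eval_sub, eval_C, eval_carlitzPoly_of_monic hφ hm, sub_self]
  · rw [hdeg, natDegree_finsetProd_X_sub_C_eq_card, card_monics]
  · rw [hmon.leadingCoeff, hmon'.leadingCoeff]

lemma derivative_carlitzPoly (d : ℕ) :
    derivative (carlitzPoly φ d) = C (φ (D F d) * (φ (L F d))⁻¹) := by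
  have hq : (Fintype.card F : K) = 0 := by
    rw [← map_natCast (φ.comp C), FiniteField.cast_card_eq_zero, map_zero]
  rw [carlitzPoly, Finset.sum_range_succ', derivative_add, derivative_sum, Finset.sum_eq_zero]
  · simp [D_zero]
  · intro i _
    rw [derivative_C_mul_X_pow, Nat.cast_pow, hq, zero_pow (by omega)]
    simp

end CarlitzPolynomial

/-! ### Generating series of power sums -/

section PowerSums

variable {F : Type*} [Field F] [Fintype F] {K : Type*} [Field K] (φ : F[X] →+* K)

/-- The power sum `∑ 1 / a ^ s` over the monic polynomials `a` of degree `d`. -/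
def powerSum (d s : ℕ) : K := ∑ a ∈ monics F d, ((φ a) ^ s)⁻¹

/-- The power series `∑ n, L_d ^ (n + 1) S_d(n + 1) x ^ n`. -/
def powerSumSeries (d : ℕ) : PowerSeries K :=
  PowerSeries.mk fun n => φ (L F d) ^ (n + 1) * powerSum φ d (n + 1)

variable {φ}

/-- The logarithmic derivative of `prod_monics`, evaluated at X = L_d x: the derivative of E_d is
the constant D_d / L_d, and each 1/(X - a) expands as a geometric series. The subtracted sum is
E_d(L_d x) / D_d. -/
lemma powerSumSeries_mul (hφ : Function.Injective φ) (d : ℕ) :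
    powerSumSeries φ d * (1 - ∑ i ∈ Finset.range (d + 1),
      PowerSeries.C ((φ (D F i))⁻¹ * (φ (L F (d - i)))⁻¹ ^ Fintype.card F ^ i *
        φ (L F d) ^ Fintype.card F ^ i) * PowerSeries.X ^ Fintype.card F ^ i) = 1 := by
  classical
  have hD : φ (D F d) ≠ 0 := (map_ne_zero_iff φ hφ).2 (D_ne_zero d)
  have hL : φ (L F d) ≠ 0 := (map_ne_zero_iff φ hφ).2 (L_ne_zero d)
  let ψ : K[X] →+* PowerSeries K :=
    eval₂RingHom PowerSeries.C (PowerSeries.C (φ (L F d)) * PowerSeries.X)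
  have hψC (x : K) : ψ (C x) = PowerSeries.C x := by simp [ψ]
  have hψX : ψ X = PowerSeries.C (φ (L F d)) * PowerSeries.X := by simp [ψ]
  have hT : powerSumSeries φ d = ∑ a ∈ monics F d, PowerSeries.C (φ (L F d) * (φ a)⁻¹) *
      PowerSeries.mk fun n => (φ (L F d) * (φ a)⁻¹) ^ n := by
    ext n
    simp only [powerSumSeries, powerSum, PowerSeries.coeff_mk, map_sum, PowerSeries.coeff_C_mul,
      Finset.mul_sum]
    exact Finset.sum_congr rfl fun a _ => by rw [← pow_succ', mul_pow, inv_pow]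
  have hgeom (b : K) : (PowerSeries.mk fun n => b ^ n) * (1 - PowerSeries.C b * PowerSeries.X)
      = 1 := by
    ext n
    rw [mul_sub, mul_one, mul_comm (PowerSeries.C b), ← mul_assoc, map_sub,
      PowerSeries.coeff_mul_C, PowerSeries.coeff_mk, PowerSeries.coeff_one]
    cases n with
    | zero => simp
    | succ n => simp [PowerSeries.coeff_succ_mul_X, pow_succ]
  have hterm : ∀ a ∈ monics F d, (PowerSeries.C (φ (L F d) * (φ a)⁻¹) *
      PowerSeries.mk fun n => (φ (L F d) * (φ a)⁻¹) ^ n) * ψ (X - C (φ a)) =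
      -PowerSeries.C (φ (L F d)) := by
    intro a ha
    have ha0 : φ a ≠ 0 := (map_ne_zero_iff φ hφ).2 (mem_monics.1 ha).1.ne_zero
    have h1 : ψ (X - C (φ a)) = -PowerSeries.C (φ a) *
        (1 - PowerSeries.C (φ (L F d) * (φ a)⁻¹) * PowerSeries.X) := by
      have h2 : PowerSeries.C (φ a) * PowerSeries.C (φ (L F d) * (φ a)⁻¹)
          = PowerSeries.C (φ (L F d)) := by
        rw [← map_mul]
        congr 1
        field_simp
      rw [map_sub, hψX, hψC, ← h2]
      ring
    have h3 : PowerSeries.C (φ (L F d) * (φ a)⁻¹) * PowerSeries.C (φ a)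
          = PowerSeries.C (φ (L F d)) := by
      rw [← map_mul]
      congr 1
      field_simp
    rw [h1, ← h3]
    linear_combination
      -(PowerSeries.C (φ (L F d) * (φ a)⁻¹) * PowerSeries.C (φ a)) * hgeom (φ (L F d) * (φ a)⁻¹)
  -- The geometric series of a cancels the factor X - a up to -L_d, so the sum over a is -L_d times
  -- the derivative D_d / L_d of the product.
  have hM : powerSumSeries φ d * ψ (carlitzPoly φ d - C (φ (D F d))) =
      -PowerSeries.C (φ (D F d)) := by
    have hder := congrArg derivative (prod_monics hφ d)
    rw [derivative_sub, derivative_C, sub_zero, derivative_carlitzPoly, derivative_prod_finset] at hder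
    simp only [derivative_sub, derivative_X, derivative_C, sub_zero, mul_one] at hder
    have hder' := congrArg ψ hder
    rw [map_sum, hψC] at hder'
    rw [← prod_monics hφ, hT, Finset.sum_mul]
    calc _ = ∑ a ∈ monics F d, -PowerSeries.C (φ (L F d)) *
          ψ (∏ b ∈ (monics F d).erase a, (X - C (φ b))) := by
          refine Finset.sum_congr rfl fun a ha => ?_
          rw [← Finset.mul_prod_erase _ _ ha, map_mul ψ, ← mul_assoc, hterm a ha]
      _ = _ := by
          rw [← Finset.mul_sum, hder', neg_mul, ← map_mul]
          congr 2
          field_simp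
  have hE : ψ (carlitzPoly φ d) = PowerSeries.C (φ (D F d)) * ∑ i ∈ Finset.range (d + 1),
      PowerSeries.C ((φ (D F i))⁻¹ * (φ (L F (d - i)))⁻¹ ^ Fintype.card F ^ i *
        φ (L F d) ^ Fintype.card F ^ i) * PowerSeries.X ^ Fintype.card F ^ i := by
    rw [carlitzPoly, map_sum, Finset.mul_sum]
    refine Finset.sum_congr rfl fun i _ => ?_
    rw [map_mul, map_pow, hψC, hψX, mul_pow]
    simp only [map_mul, map_pow]
    ring
  have hC : PowerSeries.C (φ (D F d)) ≠ 0 := by simpa using hD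
  refine mul_left_cancel₀ hC ?_
  rw [map_sub, hψC, hE] at hM
  linear_combination -hM

end PowerSums

/-! ### Anderson–Thakur polynomials and the interpolation of power sums -/

section AndersonThakurPolynomials

variable {F : Type*} [Field F] [Fintype F]

lemma toFty_H (n : ℕ) : toFty F (H F n) = frakH F n := (frakH_mem_range (F := F) n).choose_spec

variable (F) in
-- `Fty F` is built as F(t)(y) whereas A[t] is F[θ][t]; once the two variables are swapped, the map
-- is a composite of injections of coefficients and into fraction fields.
lemma toFty_injective : Function.Injective (toFty F) := by
  have hC (a : F[X]) : toFty F (C a) = algebraMap (RatFunc F)[X] (Fty F)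
      ((Bivariate.swap (R := F) (C a)).map (algebraMap F[X] (RatFunc F))) := by
    rw [toFty_C, Bivariate.swap_C, map_map]
    induction a using Polynomial.induction_on' with
    | add p q hp hq => rw [map_add, hp, hq, Polynomial.map_add, map_add]
    | monomial n a =>
      have h : algebraMap F (Fty F) a = RatFunc.C (RatFunc.C a) := by
        rw [IsScalarTower.algebraMap_apply F (RatFunc F) (Fty F), RatFunc.algebraMap_eq_C,
          RatFunc.algebraMap_eq_C]
      simp [← C_mul_X_pow_eq_monomial, varY, h, RatFunc.algebraMap_X, RatFunc.algebraMap_C]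
  have hX : toFty F X = algebraMap (RatFunc F)[X] (Fty F)
      ((Bivariate.swap (R := F) X).map (algebraMap F[X] (RatFunc F))) := by
    rw [Bivariate.swap_Y]
    simp [toFty, varT, RatFunc.algebraMap_C]
  have h (p : F[X][X]) : toFty F p = algebraMap (RatFunc F)[X] (Fty F)
      ((Bivariate.swap (R := F) p).map (algebraMap F[X] (RatFunc F))) := by
    induction p using Polynomial.induction_on' with
    | add p q hp hq => rw [map_add, hp, hq, map_add, Polynomial.map_add, map_add]
    | monomial n a =>
      rw [← C_mul_X_pow_eq_monomial, map_mul, map_pow, hC, hX, map_mul, map_pow,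
        Polynomial.map_mul, Polynomial.map_pow, map_mul, map_pow]
  intro p p' hp
  rw [h, h] at hp
  exact (Bivariate.swap (R := F)).injective
    (map_injective _ (RatFunc.algebraMap_injective F) (RatFunc.algebraMap_injective _ hp))

variable (F) in
/-- `G_i(t, θ)` as an element of `A[t]`. -/
def polyG (i : ℕ) : F[X][X] :=
  ∏ j ∈ Finset.Icc 1 i, (X ^ (Fintype.card F ^ i) - C (X ^ (Fintype.card F ^ j)))

lemma toFty_polyG (i : ℕ) : toFty F (polyG F i) = G F i := by
  rw [polyG, map_prod, G]
  refine Finset.prod_congr rfl fun j _ => ?_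
  rw [map_sub, map_pow, toFty_C, map_pow, aeval_X]
  simp [toFty]

variable (F) in
/-- The quotient `Π(m + q ^ i) / (D_i Π(m))`. -/
def factorialQuot (i m : ℕ) : F[X] := (D_mul_factorial_dvd (F := F) m i).choose

lemma factorial_add_pow_eq (i m : ℕ) :
    factorial F (m + Fintype.card F ^ i) = D F i * factorial F m * factorialQuot F i m :=
  (D_mul_factorial_dvd (F := F) m i).choose_spec

/-- The defining relation (1 - 𝒢)⁻¹ = 1 + 𝒢 (1 - 𝒢)⁻¹, cleared of denominators so that it lives in
A[t] and can be specialized by `twist`. -/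
lemma H_eq (n : ℕ) : H F n = (if n = 0 then 1 else 0) + ∑ i ∈ Finset.range (n + 1),
    if Fintype.card F ^ i ≤ n then (factorialQuot F i (n - Fintype.card F ^ i)).map C *
      polyG F i * H F (n - Fintype.card F ^ i) else 0 := by
  apply toFty_injective F
  have hS : (1 - GSeries F) * (1 - GSeries F)⁻¹ = 1 :=
    PowerSeries.mul_inv_cancel _ (by simp [constantCoeff_GSeries])
  have hT : (1 - GSeries F)⁻¹ = 1 + GSeries F * (1 - GSeries F)⁻¹ := by
    linear_combination hS
  have hcoeff : PowerSeries.coeff n (GSeries F * (1 - GSeries F)⁻¹) =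
      ∑ i ∈ Finset.range (n + 1), if Fintype.card F ^ i ≤ n then
        G F i / aeval (varT F) (D F i) *
          PowerSeries.coeff (n - Fintype.card F ^ i) (1 - GSeries F)⁻¹ else 0 := by
    rw [PowerSeries.coeff_mul, Finset.Nat.sum_antidiagonal_eq_sum_range_succ_mk]
    have hc : ∀ a ∈ Finset.range (n + 1), PowerSeries.coeff a (GSeries F) =
        ∑ i ∈ Finset.range (n + 1),
          if Fintype.card F ^ i = a then G F i / aeval (varT F) (D F i) else 0 := by
      intro a ha
      rw [GSeries, PowerSeries.coeff_mk]
      refine Finset.sum_subset (Finset.range_subset_range.2 (Finset.mem_range.1 ha)) ?_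
      intro i _ hi
      have := Nat.lt_pow_self (n := i) (Fintype.one_lt_card (α := F))
      rw [if_neg]
      simp only [Finset.mem_range] at hi
      omega
    rw [Finset.sum_congr rfl fun a ha => by rw [hc a ha, Finset.sum_mul], Finset.sum_comm]
    refine Finset.sum_congr rfl fun i _ => ?_
    simp only [ite_mul, zero_mul]
    rw [Finset.sum_ite_eq]
    simp only [Finset.mem_range, Nat.lt_succ_iff]
  rw [toFty_H, frakH, hT, map_add, hcoeff, mul_add, PowerSeries.coeff_one, map_add, map_sum,
    Finset.mul_sum]
  congr 1
  · split_ifs with h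
    · subst h
      simp [Gamma, factorial]
    · simp
  · refine Finset.sum_congr rfl fun i _ => ?_
    split_ifs with h
    · have hD : aeval (varT F) (D F i) ≠ 0 := by
        rw [aeval_varT]
        simpa using D_ne_zero i
      rw [map_mul, map_mul, toFty_map_C, toFty_polyG, toFty_H, frakH, Gamma, Gamma,
        Nat.add_sub_cancel, Nat.add_sub_cancel]
      conv_lhs => rw [← Nat.sub_add_cancel h, factorial_add_pow_eq, map_mul, map_mul,
        Nat.add_sub_cancel]
      field_simp
    · simp

/-- The specialization `θ ↦ θ ^ (q ^ d)`, `t ↦ θ` of `A[t]`. -/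
def twist (d : ℕ) : F[X][X] →+* F[X] :=
  eval₂RingHom (powCard C d) X

lemma twist_eq_sum (d : ℕ) (p : F[X][X]) :
    twist d p = ∑ j ∈ Finset.range (p.natDegree + 1), p.coeff j ^ Fintype.card F ^ d * X ^ j := by
  rw [twist, coe_eval₂RingHom, eval₂_eq_sum_range]
  simp only [powCard_apply]

lemma twist_map_C (d : ℕ) (p : F[X]) : twist d (p.map C) = p := by
  rw [twist, coe_eval₂RingHom, eval₂_map]
  have h : (powCard (C : F →+* F[X]) d).comp C = C := by
    ext a
    simp [powCard_apply, ← map_pow, FiniteField.pow_card_pow]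
  rw [h, eval₂_C_X]

lemma twist_polyG (d i : ℕ) : twist d (polyG F i) =
    ∏ j ∈ Finset.Icc 1 i, (X ^ Fintype.card F ^ i - X ^ Fintype.card F ^ (d + j)) := by
  rw [polyG, map_prod]
  refine Finset.prod_congr rfl fun j _ => ?_
  rw [twist, coe_eval₂RingHom, eval₂_sub, eval₂_C, eval₂_X_pow, powCard_apply, ← pow_mul, ← pow_add,
    add_comm j]

lemma twist_polyG_eq_zero {d i : ℕ} (h : d < i) : twist d (polyG F i) = 0 := by
  rw [twist_polyG]
  refine Finset.prod_eq_zero (i := i - d) (Finset.mem_Icc.2 (by omega)) ?_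
  rw [show d + (i - d) = i by omega, sub_self]

lemma L_add (m i : ℕ) : L F (m + i) = L F m * ∏ j ∈ Finset.Icc 1 i, -bracket F (m + j) := by
  induction i with
  | zero => simp
  | succ i ih =>
    rw [← add_assoc, L_succ, ih, Finset.prod_Icc_succ_top (by omega)]
    ring_nf

lemma L_pow_eq {d i : ℕ} (h : i ≤ d) :
    L F d ^ Fintype.card F ^ i = L F (d - i) ^ Fintype.card F ^ i * twist d (polyG F i) := by
  conv_lhs => rw [← Nat.sub_add_cancel h, L_add, mul_pow, ← Finset.prod_pow]
  rw [twist_polyG]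
  congr 1
  refine Finset.prod_congr rfl fun j _ => ?_
  rw [neg_pow_card_pow C, bracket_pow, neg_sub, show d - i + j + i = d + j by omega]

variable {K : Type*} [Field K] {φ : F[X] →+* K}

lemma factorial_ne_zero (n : ℕ) : factorial F n ≠ 0 :=
  Finset.prod_ne_zero_iff.2 fun i _ => pow_ne_zero _ (D_ne_zero i)

lemma twist_H_div (hφ : Function.Injective φ) (d n : ℕ) :
    φ (twist d (H F n)) / φ (factorial F n) = (if n = 0 then 1 else 0) +
      ∑ i ∈ Finset.range (n + 1), if Fintype.card F ^ i ≤ n then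
        φ (twist d (polyG F i)) / φ (D F i) * (φ (twist d (H F (n - Fintype.card F ^ i))) /
          φ (factorial F (n - Fintype.card F ^ i))) else 0 := by
  have hf (m : ℕ) : φ (factorial F m) ≠ 0 := (map_ne_zero_iff φ hφ).2 (factorial_ne_zero m)
  have hD (m : ℕ) : φ (D F m) ≠ 0 := (map_ne_zero_iff φ hφ).2 (D_ne_zero m)
  rw [H_eq, map_add, map_add, map_sum, map_sum, add_div, Finset.sum_div]
  congr 1
  · split_ifs with h
    · subst h
      simp [factorial]
    · simp
  · refine Finset.sum_congr rfl fun i _ => ?_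
    split_ifs with h
    · rw [map_mul, map_mul, map_mul, map_mul, twist_map_C]
      have h2 := congrArg φ (factorial_add_pow_eq (F := F) i (n - Fintype.card F ^ i))
      rw [Nat.sub_add_cancel h, map_mul, map_mul] at h2
      have h3 := hf n
      rw [h2] at h3 ⊢
      have h4 := right_ne_zero_of_mul h3
      field_simp [hD i, hf (n - Fintype.card F ^ i)]
    · simp

/-- By `L_pow_eq` the coefficient of x^(q^i) in E_d(L_d x) / D_d is G_i(θ, θ^(q^d)) / D_i, so this
is the recursion of `twist_H_div`. -/
lemma coeff_powerSumSeries (hφ : Function.Injective φ) (d n : ℕ) :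
    PowerSeries.coeff n (powerSumSeries φ d) = (if n = 0 then 1 else 0) +
      ∑ i ∈ Finset.range (n + 1), if Fintype.card F ^ i ≤ n then
        φ (twist d (polyG F i)) / φ (D F i) *
          PowerSeries.coeff (n - Fintype.card F ^ i) (powerSumSeries φ d) else 0 := by
  have h := powerSumSeries_mul hφ d
  have hc : ∀ i ∈ Finset.range (d + 1), (φ (D F i))⁻¹ * (φ (L F (d - i)))⁻¹ ^ Fintype.card F ^ i *
      φ (L F d) ^ Fintype.card F ^ i = φ (twist d (polyG F i)) / φ (D F i) := by
    intro i hi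
    have hL : φ (L F (d - i)) ≠ 0 := (map_ne_zero_iff φ hφ).2 (L_ne_zero _)
    rw [← map_pow φ (L F d), L_pow_eq (Nat.lt_succ_iff.1 (Finset.mem_range.1 hi)), map_mul,
      map_pow, inv_pow]
    field_simp
  rw [Finset.sum_congr rfl fun i hi => by rw [hc i hi]] at h
  have h2 := congrArg (PowerSeries.coeff n) (sub_eq_iff_eq_add'.1 ((mul_one_sub _ _).symm.trans h))
  rw [map_add, PowerSeries.coeff_one, add_comm, Finset.mul_sum, map_sum] at h2
  rw [h2]
  congr 1
  have hterm (i : ℕ) : PowerSeries.coeff n (powerSumSeries φ d *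
      (PowerSeries.C (φ (twist d (polyG F i)) / φ (D F i)) * PowerSeries.X ^ Fintype.card F ^ i)) =
      if Fintype.card F ^ i ≤ n then φ (twist d (polyG F i)) / φ (D F i) *
          PowerSeries.coeff (n - Fintype.card F ^ i) (powerSumSeries φ d) else 0 := by
    rw [mul_left_comm, PowerSeries.coeff_C_mul, PowerSeries.coeff_mul_X_pow']
    split_ifs <;> simp
  simp only [hterm]
  -- Both sums are extended to a common range: the twisted G_i vanishes for i > d, and q^i > n for i
  -- > n.
  rw [Finset.sum_subset (Finset.range_subset_range.2 (Nat.le_add_right (d + 1) (n + 1)))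
      (fun i _ hi => ?_),
    Finset.sum_subset (Finset.range_subset_range.2 (Nat.le_add_left (n + 1) (d + 1)))
      (fun i _ hi => ?_)]
  · have := Nat.lt_pow_self (n := i) (Fintype.one_lt_card (α := F))
    rw [if_neg]
    simp only [Finset.mem_range] at hi
    omega
  · simp only [Finset.mem_range] at hi
    rw [twist_polyG_eq_zero (by omega)]
    simp

/-- The Anderson–Thakur interpolation formula for power sums. -/
lemma twist_H (hφ : Function.Injective φ) (d n : ℕ) :
    φ (twist d (H F n)) = φ (factorial F n) * (φ (L F d) ^ (n + 1) * powerSum φ d (n + 1)) := by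
  have hf (m : ℕ) : φ (factorial F m) ≠ 0 := (map_ne_zero_iff φ hφ).2 (factorial_ne_zero m)
  rw [mul_comm, ← div_eq_iff (hf n)]
  have h : φ (twist d (H F n)) / φ (factorial F n) =
      PowerSeries.coeff n (powerSumSeries φ d) := by
    induction n using Nat.strong_induction_on with
    | _ n ih =>
    rw [twist_H_div hφ, coeff_powerSumSeries hφ]
    congr 1
    refine Finset.sum_congr rfl fun i _ => ?_
    split_ifs with hi
    · have hpos : 0 < Fintype.card F ^ i := pow_pos Fintype.card_pos _
      rw [ih _ (by omega)]
    · rfl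
  rw [h, powerSumSeries, PowerSeries.coeff_mk]

lemma sum_u_pow (hφ : Function.Injective φ) (d : ℕ) {s : ℕ} (hs : 1 ≤ s) :
    ∑ j ∈ Finset.range ((H F (s - 1)).natDegree + 1), φ (u F s j) ^ Fintype.card F ^ d * φ X ^ j =
      φ (Gamma F s) * (φ (L F d) ^ s * powerSum φ d s) := by
  have h := twist_H hφ d (s - 1)
  rw [Nat.sub_add_cancel hs, twist_eq_sum, map_sum] at h
  simpa only [map_mul, map_pow, u, Gamma] using h

/-- The case n = 0 of the interpolation formula, where H_0 = 1 and Π(0) = 1. -/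
lemma powerSum_one (hφ : Function.Injective φ) (d : ℕ) : powerSum φ d 1 = (φ (L F d))⁻¹ := by
  have hL : φ (L F d) ≠ 0 := (map_ne_zero_iff φ hφ).2 (L_ne_zero _)
  have h := twist_H hφ d 0
  have h0 : H F 0 = 1 := by
    rw [H_eq]
    simp
  rw [h0, map_one, map_one] at h
  refine eq_inv_of_mul_eq_one_right ?_
  simpa [factorial] using h.symm

end AndersonThakurPolynomials

/-! ### Digit sums in base q -/

section DigitSum

/-- The sum of the digits of `n` in base `q`. -/
def digitSum (q n : ℕ) : ℕ := (Nat.digits q n).sum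

lemma digitSum_eq {q : ℕ} (hq : 1 < q) (n : ℕ) : digitSum q n = n % q + digitSum q (n / q) := by
  rcases Nat.eq_zero_or_pos n with rfl | hn
  · simp [digitSum]
  · rw [digitSum, Nat.digits_def' hq hn, List.sum_cons, digitSum]

lemma digitSum_add_mul {q c : ℕ} (hq : 1 < q) (hc : c < q) (n : ℕ) :
    digitSum q (c + q * n) = c + digitSum q n := by
  rw [digitSum_eq hq, Nat.add_mul_mod_self_left, Nat.mod_eq_of_lt hc,
    Nat.add_mul_div_left _ _ (by omega), Nat.div_eq_of_lt hc, zero_add]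

lemma digitSum_zero (q : ℕ) : digitSum q 0 = 0 := by simp [digitSum]

lemma digitSum_pow {q : ℕ} (hq : 1 < q) (i : ℕ) : digitSum q (q ^ i) = 1 := by
  induction i with
  | zero => simpa [digitSum_zero] using digitSum_add_mul hq hq 0
  | succ i ih => simpa [pow_succ', ih] using digitSum_add_mul hq (c := 0) (by omega) (q ^ i)

lemma digitSum_pow_sub_one {q : ℕ} (hq : 1 < q) (d : ℕ) :
    digitSum q (q ^ d - 1) = d * (q - 1) := by
  induction d with
  | zero => simp [digitSum_zero]
  | succ d ih =>
    have h : q ^ (d + 1) - 1 = (q - 1) + q * (q ^ d - 1) := by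
      have h1 : 0 < q ^ d := pow_pos (by omega) d
      obtain ⟨m, hm⟩ : ∃ m, q ^ d = m + 1 := ⟨q ^ d - 1, by omega⟩
      rw [pow_succ', hm, Nat.add_sub_cancel, mul_add]
      omega
    rw [h, digitSum_add_mul hq (by omega), ih]
    ring

lemma digitSum_succ_le {q : ℕ} (hq : 1 < q) (n : ℕ) :
    digitSum q (n + 1) ≤ digitSum q n + 1 := by
  induction n using Nat.strong_induction_on with
  | _ n ih =>
  have hlt := Nat.mod_lt n (show 0 < q by omega)
  have hn := Nat.mod_add_div n q
  by_cases h : n % q + 1 < q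
  · have h1 : n + 1 = (n % q + 1) + q * (n / q) := by omega
    rw [h1, digitSum_add_mul hq h, digitSum_eq hq n]
    omega
  · have h1 : n + 1 = 0 + q * (n / q + 1) := by rw [mul_add]; omega
    have h2 := ih (n / q) (Nat.div_lt_self (Nat.pos_of_ne_zero fun h0 => by simp [h0] at h; omega) hq)
    rw [h1, digitSum_add_mul hq (by omega), digitSum_eq hq n]
    omega

/-- A carry trades q units in one place for a single unit in the next. -/
lemma digitSum_add_le {q : ℕ} (hq : 1 < q) (a b : ℕ) :
    digitSum q (a + b) ≤ digitSum q a + digitSum q b := by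
  induction a using Nat.strong_induction_on generalizing b with
  | _ a ih =>
  rcases Nat.eq_zero_or_pos a with rfl | ha
  · simp
  have hla := Nat.mod_lt a (show 0 < q by omega)
  have hlb := Nat.mod_lt b (show 0 < q by omega)
  have hna := Nat.mod_add_div a q
  have hnb := Nat.mod_add_div b q
  have h2 := ih (a / q) (Nat.div_lt_self ha hq) (b / q)
  have h3 := digitSum_succ_le hq (a / q + b / q)
  have ea := digitSum_eq hq a
  have eb := digitSum_eq hq b
  by_cases h : a % q + b % q < q
  · have h1 : a + b = (a % q + b % q) + q * (a / q + b / q) := by rw [mul_add]; omega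
    rw [h1, digitSum_add_mul hq h]
    omega
  · have h1 : a + b = (a % q + b % q - q) + q * (a / q + b / q + 1) := by
      rw [mul_add, mul_add]; omega
    rw [h1, digitSum_add_mul hq (by omega)]
    omega

end DigitSum

/-! ### Coefficients of powers of q-linear power series -/

section PowerSeries

variable {F : Type*} [Field F] [Fintype F] {K : Type*} [Field K]

lemma coeff_pow_card_pow (f : F →+* K) (g : PowerSeries K) (j n : ℕ) :
    PowerSeries.coeff n (g ^ Fintype.card F ^ j) =
      if Fintype.card F ^ j ∣ n then
        PowerSeries.coeff (n / Fintype.card F ^ j) g ^ Fintype.card F ^ j else 0 := by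
  obtain ⟨p, hp⟩ := CharP.exists F
  obtain ⟨m, hpp, hm⟩ := FiniteField.card F p
  have : CharP K p := charP_of_injective_ringHom f.injective p
  have : ExpChar K p := .prime hpp
  have h0 : p ^ (m * j : ℕ) ≠ 0 := pow_ne_zero _ hpp.ne_zero
  have h : PowerSeries.map (iterateFrobenius K p (m * j)) (PowerSeries.expand _ h0 g) =
      g ^ p ^ (m * j : ℕ) := MvPowerSeries.map_iterateFrobenius_expand p hpp.ne_zero g (m * j)
  rw [hm, ← pow_mul, ← h, PowerSeries.coeff_map, PowerSeries.coeff_expand, iterateFrobenius_def]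
  split_ifs
  · rfl
  · exact zero_pow h0

/-- Power series whose exponents have digit sum at most `N`. -/
def HasDigitSumLE (q N : ℕ) (g : PowerSeries K) : Prop :=
  ∀ n, PowerSeries.coeff n g ≠ 0 → digitSum q n ≤ N

lemma HasDigitSumLE.mul {q M N : ℕ} (hq : 1 < q) {f g : PowerSeries K}
    (hf : HasDigitSumLE q M f) (hg : HasDigitSumLE q N g) : HasDigitSumLE q (M + N) (f * g) := by
  intro n hn
  rw [PowerSeries.coeff_mul] at hn
  obtain ⟨⟨a, b⟩, hab, h⟩ := Finset.exists_ne_zero_of_sum_ne_zero hn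
  rw [← Finset.HasAntidiagonal.mem_antidiagonal.1 hab]
  exact (digitSum_add_le hq a b).trans
    (add_le_add (hf a (left_ne_zero_of_mul h)) (hg b (right_ne_zero_of_mul h)))

lemma hasDigitSumLE_one (q : ℕ) : HasDigitSumLE q 0 (1 : PowerSeries K) := by
  intro n hn
  rw [PowerSeries.coeff_one] at hn
  have h : n = 0 := by by_contra h; simp [h] at hn
  simp [h, digitSum_zero]

lemma HasDigitSumLE.pow {q N : ℕ} (hq : 1 < q) {f : PowerSeries K}
    (hf : HasDigitSumLE q N f) (k : ℕ) : HasDigitSumLE q (k * N) (f ^ k) := by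
  induction k with
  | zero => simpa using hasDigitSumLE_one q
  | succ k ih =>
    rw [pow_succ, Nat.succ_mul]
    exact ih.mul hq hf

lemma pow_sub_one_succ {q : ℕ} (hq : 1 < q) (m : ℕ) :
    q ^ (m + 1) - 1 = (q ^ m - 1) + q ^ m * (q - 1) := by
  have h1 : 0 < q ^ m := pow_pos (by omega) m
  rw [Nat.mul_sub, pow_succ, mul_one]
  have : q ^ m ≤ q ^ m * q := Nat.le_mul_of_pos_right _ (by omega)
  omega

/-- Since q^m - 1 = ∑_(k<m) (q-1) q^k, the power is a product of m(q-1) series g^(q^k), whose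
exponents are powers of q and so have digit sum 1. -/
lemma hasDigitSumLE_pow_sub_one (f : F →+* K) {g : PowerSeries K}
    (hg : ∀ n, PowerSeries.coeff n g ≠ 0 → ∃ i, n = Fintype.card F ^ i) (m : ℕ) :
    HasDigitSumLE (Fintype.card F) (m * (Fintype.card F - 1)) (g ^ (Fintype.card F ^ m - 1)) := by
  have hq : 1 < Fintype.card F := Fintype.one_lt_card
  induction m with
  | zero => simpa using hasDigitSumLE_one _
  | succ m ih =>
    have h1 : HasDigitSumLE (Fintype.card F) 1 (g ^ Fintype.card F ^ m) := by
      intro n hn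
      rw [coeff_pow_card_pow f] at hn
      by_cases hd : Fintype.card F ^ m ∣ n
      · rw [if_pos hd] at hn
        obtain ⟨i, hi⟩ := hg _ (pow_ne_zero_iff (pow_ne_zero _ Fintype.card_ne_zero) |>.1 hn)
        rw [← Nat.div_mul_cancel hd, hi, ← pow_add, digitSum_pow hq]
      · simp [hd] at hn
    rw [pow_sub_one_succ hq, pow_add, pow_mul, Nat.succ_mul]
    simpa using ih.mul hq (h1.pow hq (Fintype.card F - 1))

/-- For m < d the exponent q^d - 1 has digit sum d(q-1), too large to occur; for m > d the power is
divisible by z^(q^m - 1); for m = d the leading coefficient is read off. -/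
lemma coeff_pow_sub_one (f : F →+* K) {g : PowerSeries K}
    (hg : ∀ n, PowerSeries.coeff n g ≠ 0 → ∃ i, n = Fintype.card F ^ i)
    (hg1 : PowerSeries.coeff 1 g = 1) (d m : ℕ) :
    PowerSeries.coeff (Fintype.card F ^ d - 1) (g ^ (Fintype.card F ^ m - 1)) =
      if m = d then 1 else 0 := by
  have hq : 1 < Fintype.card F := Fintype.one_lt_card
  have hX : PowerSeries.X ∣ g := by
    rw [PowerSeries.X_dvd_iff, ← PowerSeries.coeff_zero_eq_constantCoeff_apply]
    by_contra h
    obtain ⟨i, hi⟩ := hg 0 h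
    exact (pow_ne_zero i Fintype.card_ne_zero) hi.symm
  obtain ⟨g', rfl⟩ := hX
  rcases lt_trichotomy m d with h | rfl | h
  · rw [if_neg h.ne]
    by_contra hn
    have h1 := hasDigitSumLE_pow_sub_one f hg m _ hn
    rw [digitSum_pow_sub_one hq] at h1
    have := Nat.mul_lt_mul_of_pos_right h (show 0 < Fintype.card F - 1 by omega)
    omega
  · rw [if_pos rfl, mul_pow, PowerSeries.coeff_X_pow_mul', if_pos le_rfl, Nat.sub_self,
      PowerSeries.coeff_zero_eq_constantCoeff_apply, map_pow]
    rw [show 1 = 0 + 1 by rfl, PowerSeries.coeff_succ_X_mul,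
      PowerSeries.coeff_zero_eq_constantCoeff_apply] at hg1
    rw [hg1, one_pow]
  · rw [if_neg h.ne', mul_pow, PowerSeries.coeff_X_pow_mul', if_neg]
    have := Nat.pow_lt_pow_right hq h
    have : 0 < Fintype.card F ^ d := pow_pos (by omega) _
    omega

/-- Distributivity for a locally finite sum: `w i` bounds the order of `T i` from below, so only
finitely many terms meet a given coefficient. -/
lemma mk_finsum_coeff_mul {ι : Type*} (e : PowerSeries K) (T : ι → PowerSeries K) (w : ι → ℕ)
    (hw : ∀ n, {i | w i ≤ n}.Finite) (hT : ∀ i n, n < w i → PowerSeries.coeff n (T i) = 0) :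
    (PowerSeries.mk fun n => ∑ᶠ i, PowerSeries.coeff n (e * T i)) =
      e * PowerSeries.mk fun n => ∑ᶠ i, PowerSeries.coeff n (T i) := by
  have hsum (n m : ℕ) (hm : m ≤ n) : ∑ᶠ i, PowerSeries.coeff m (T i) =
      ∑ i ∈ (hw n).toFinset, PowerSeries.coeff m (T i) := by
    refine finsum_eq_sum_of_support_subset _ fun i hi => ?_
    rw [Set.Finite.coe_toFinset]
    by_contra h
    exact hi (hT i m (hm.trans_lt (not_le.1 h)))
  ext n
  rw [PowerSeries.coeff_mk, PowerSeries.coeff_mul]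
  have h1 : ∑ᶠ i, PowerSeries.coeff n (e * T i) =
      ∑ i ∈ (hw n).toFinset, PowerSeries.coeff n (e * T i) := by
    refine finsum_eq_sum_of_support_subset _ fun i hi => ?_
    rw [Set.Finite.coe_toFinset]
    by_contra h
    refine hi ?_
    change PowerSeries.coeff n (e * T i) = 0
    rw [PowerSeries.coeff_mul]
    refine Finset.sum_eq_zero fun ab hab => ?_
    have := Finset.HasAntidiagonal.mem_antidiagonal.1 hab
    have h2 : ¬ w i ≤ n := h
    rw [hT i _ (by omega), mul_zero]
  rw [h1]
  simp only [PowerSeries.coeff_mul]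
  rw [Finset.sum_comm]
  refine Finset.sum_congr rfl fun ab hab => ?_
  have := Finset.HasAntidiagonal.mem_antidiagonal.1 hab
  rw [PowerSeries.coeff_mk, hsum n _ (by omega), Finset.mul_sum]

/-- The coefficient of `z ^ (q ^ d - 1)` in `(∑ i, c_i g ^ (q ^ k_i)) / g`, for a power series
`g = z + ⋯` in which only powers `z ^ (q ^ j)` occur. -/
lemma coeff_mk_finsum_div (f : F →+* K) {g : PowerSeries K}
    (hg : ∀ n, PowerSeries.coeff n g ≠ 0 → ∃ i, n = Fintype.card F ^ i)
    (hg1 : PowerSeries.coeff 1 g = 1) {ι : Type*} (k : ι → ℕ) (hk : ∀ n, {i | k i ≤ n}.Finite)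
    (c : ι → K) (d : ℕ) :
    HahnSeries.coeff ((((PowerSeries.mk fun n => ∑ᶠ i,
      PowerSeries.coeff n (g ^ Fintype.card F ^ k i * PowerSeries.C (c i)) : PowerSeries K)) :
        LaurentSeries K) / (g : LaurentSeries K)) ((Fintype.card F ^ d - 1 : ℕ) : ℤ) =
      ∑ᶠ i, if k i = d then c i else 0 := by
  have hq : 1 < Fintype.card F := Fintype.one_lt_card
  have hX : PowerSeries.X ∣ g := by
    rw [PowerSeries.X_dvd_iff, ← PowerSeries.coeff_zero_eq_constantCoeff_apply]
    by_contra h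
    obtain ⟨i, hi⟩ := hg 0 h
    exact (pow_ne_zero i Fintype.card_ne_zero) hi.symm
  have hg0 : (g : LaurentSeries K) ≠ 0 := by
    intro h
    have h2 : g = 0 := HahnSeries.ofPowerSeries_injective (Γ := ℤ) (by simpa using h)
    simp [h2] at hg1
  have hpow (i : ι) : g ^ Fintype.card F ^ k i * PowerSeries.C (c i) =
      g * (g ^ (Fintype.card F ^ k i - 1) * PowerSeries.C (c i)) := by
    rw [← mul_assoc, ← pow_succ', Nat.sub_add_cancel (Nat.one_le_pow _ _ (by omega))]
  simp only [hpow]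
  -- One factor g leaves every term and cancels the denominator, so the quotient is a genuine power
  -- series.
  rw [mk_finsum_coeff_mul g _ k hk, PowerSeries.coe_mul, mul_div_cancel_left₀ _ hg0,
    LaurentSeries.coeff_coe_powerSeries, PowerSeries.coeff_mk]
  · simp only [PowerSeries.coeff_mul_C, coeff_pow_sub_one f hg hg1, ite_mul, one_mul, zero_mul]
  · intro i n hn
    rw [PowerSeries.coeff_mul_C, (PowerSeries.X_pow_dvd_iff.1 (pow_dvd_pow_of_dvd hX _)) n,
      zero_mul]
    -- The order is at least q^(k i) - 1, hence at least `k i`, as the choice of weight requires.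
    have := Nat.lt_pow_self (n := k i) hq
    omega

end PowerSeries

lemma incl_injective (F F' : Type*) [Field F] [Field F'] [Algebra F F'] :
    Function.Injective (incl F F') :=
  (RatFunc.algebraMap_injective F').comp (map_injective _ (algebraMap F F').injective)

/-! ### Bernoulli–Carlitz numbers at q^d - 1 -/

section BernoulliCarlitz

variable {F F' : Type*} [Field F] [Fintype F] [Field F'] [Algebra F F']

lemma coeff_expC_pow (m : ℕ) :
    PowerSeries.coeff (Fintype.card F ^ m) (expC F F') = (incl F F' (D F m))⁻¹ := by
  have hq : 1 < Fintype.card F := Fintype.one_lt_card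
  rw [expC, PowerSeries.coeff_mk, Finset.sum_eq_single m]
  · rw [if_pos rfl]
  · intro b _ hb
    rw [if_neg fun h => hb (Nat.pow_right_injective hq h)]
  · intro h
    have := Nat.lt_pow_self (n := m) hq
    simp only [Finset.mem_range] at h
    omega

lemma exists_eq_of_coeff_expC_ne_zero (n : ℕ) (h : PowerSeries.coeff n (expC F F') ≠ 0) :
    ∃ i, n = Fintype.card F ^ i := by
  rw [expC, PowerSeries.coeff_mk] at h
  obtain ⟨i, _, hi⟩ := Finset.exists_ne_zero_of_sum_ne_zero h
  exact ⟨i, by_contra fun hn => hi (if_neg (Ne.symm hn))⟩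

lemma coeff_one_expC : PowerSeries.coeff 1 (expC F F') = 1 := by
  have h := coeff_expC_pow (F := F) (F' := F') 0
  simpa [D_zero] using h

lemma coeff_pow_expC_pow (m i : ℕ) :
    PowerSeries.coeff (Fintype.card F ^ m) (expC F F' ^ Fintype.card F ^ i) =
      if i ≤ m then ((incl F F' (D F (m - i)))⁻¹) ^ Fintype.card F ^ i else 0 := by
  have hq : 1 < Fintype.card F := Fintype.one_lt_card
  rw [coeff_pow_card_pow ((incl F F').comp C)]
  simp only [Nat.pow_dvd_pow_iff_le_right hq]
  split_ifs with h
  · rw [Nat.pow_div h (by omega), coeff_expC_pow]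
  · rfl

/-- The logarithm applied to e_C, put in the shape that `coeff_mk_finsum_div` accepts. -/
lemma X_eq_mk_finsum : (PowerSeries.X : PowerSeries (RatFunc F')) =
    PowerSeries.mk fun n => ∑ᶠ i : ℕ, PowerSeries.coeff n
      (expC F F' ^ Fintype.card F ^ i * PowerSeries.C ((incl F F' (L F i))⁻¹)) := by
  have hq : 1 < Fintype.card F := Fintype.one_lt_card
  ext n
  rw [PowerSeries.coeff_mk, PowerSeries.coeff_X]
  simp only [PowerSeries.coeff_mul_C]
  by_cases hn : ∃ m, n = Fintype.card F ^ m
  · obtain ⟨m, rfl⟩ := hn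
    simp only [coeff_pow_expC_pow]
    rw [finsum_eq_sum_of_support_subset (s := Finset.range (m + 1))]
    · have h : ∑ i ∈ Finset.range (m + 1), (if i ≤ m then
          ((incl F F' (D F (m - i)))⁻¹) ^ Fintype.card F ^ i else 0) * (incl F F' (L F i))⁻¹ =
          ∑ i ∈ Finset.range (m + 1),
            (incl F F' (L F i))⁻¹ * ((incl F F' (D F (m - i)))⁻¹) ^ Fintype.card F ^ i := by
        refine Finset.sum_congr rfl fun i hi => ?_
        rw [if_pos (Nat.lt_succ_iff.1 (Finset.mem_range.1 hi)), mul_comm]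
      rw [h]
      cases m with
      | zero => simp [D_zero, L_zero]
      | succ m =>
        rw [sum_inv_L_mul_inv_D (incl_injective F F'), if_neg]
        exact (Nat.one_lt_pow (by omega) hq).ne'
    · intro i hi
      rw [Finset.coe_range, Set.mem_Iio]
      by_contra h
      refine hi ?_
      change (if i ≤ m then _ else _) * _ = _
      rw [if_neg (by omega), zero_mul]
  · rw [if_neg fun h => hn ⟨0, by simpa using h⟩, finsum_eq_zero_of_forall_eq_zero]
    intro i
    rw [coeff_pow_card_pow ((incl F F').comp C)]
    split_ifs with hd
    · rw [mul_eq_zero, pow_eq_zero_iff (pow_ne_zero _ (by omega))]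
      left
      by_contra h
      obtain ⟨j, hj⟩ := exists_eq_of_coeff_expC_ne_zero _ h
      exact hn ⟨j + i, by rw [pow_add, ← hj, Nat.div_mul_cancel hd]⟩
    · rw [zero_mul]

lemma BC_pow_sub_one (d : ℕ) : BC F F' (Fintype.card F ^ d - 1) =
    incl F F' (factorial F (Fintype.card F ^ d - 1)) * (incl F F' (L F d))⁻¹ := by
  have h := coeff_mk_finsum_div ((incl F F').comp C) (g := expC F F')
    exists_eq_of_coeff_expC_ne_zero coeff_one_expC (fun i : ℕ => i) (fun n => Set.finite_Iic n)
    (fun i => (incl F F' (L F i))⁻¹) d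
  rw [BC, X_eq_mk_finsum (F := F), h, finsum_eq_single _ d (fun i hi => if_neg hi), if_pos rfl]

lemma finite_strictAnti_le {r : ℕ} (i₀ : Fin r) (hi₀ : i₀.val = 0) (n : ℕ) :
    {d : {d : Fin r → ℕ // StrictAnti d} | d.1 i₀ ≤ n}.Finite := by
  refine Set.Finite.of_finite_image (f := Subtype.val) ?_ Subtype.val_injective.injOn
  refine (Set.Finite.pi' fun _ : Fin r => Set.finite_Iic n).subset ?_
  rintro _ ⟨d, hd, rfl⟩ i
  have h : i₀ ≤ i := by rw [Fin.le_def]; omega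
  exact (d.2.antitone h).trans hd

/-- Only the first slot, whose index is `i₀`, carries e_C; the term of a tuple e is therefore a
constant times e_C^(q^(e_1)), and the coefficient selects e_1 = d. -/
lemma altBC_pow_sub_one {r : ℕ} (i₀ : Fin r) (hi₀ : i₀.val = 0) (s : Fin r → ℕ)
    (γ : Fin r → F') (j : Fin r → ℕ) (d : ℕ) :
    altBC F s γ j (Fintype.card F ^ d - 1) = incl F F' (factorial F (Fintype.card F ^ d - 1)) *
      ∑ᶠ e : {e : Fin r → ℕ // StrictAnti e}, if e.1 i₀ = d then
        ∏ i, (RatFunc.C (γ i) * incl F F' (u F (s i) (j i))) ^ Fintype.card F ^ e.1 i *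
          (incl F F' (L F (e.1 i)) ^ s i)⁻¹ else 0 := by
  have h := coeff_mk_finsum_div ((incl F F').comp C) (g := expC F F')
    exists_eq_of_coeff_expC_ne_zero coeff_one_expC
    (fun e : {e : Fin r → ℕ // StrictAnti e} => e.1 i₀) (finite_strictAnti_le i₀ hi₀)
    (fun e => ∏ i, (RatFunc.C (γ i) * incl F F' (u F (s i) (j i))) ^ Fintype.card F ^ e.1 i *
          (incl F F' (L F (e.1 i)) ^ s i)⁻¹) d
  rw [altBC, ← h, Li]
  congr 5
  ext1 n
  refine finsum_congr fun e => congrArg _ ?_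
  rw [map_prod]
  have h1 : expC F F' ^ Fintype.card F ^ e.1 i₀ =
      ∏ i, (if i.val = 0 then expC F F' else 1) ^ Fintype.card F ^ e.1 i := by
    rw [Finset.prod_eq_single i₀]
    · rw [if_pos hi₀]
    · intro i _ hi
      rw [if_neg, one_pow]
      intro h
      exact hi (Fin.ext (by omega))
    · simp
  rw [h1, ← Finset.prod_mul_distrib]
  refine Finset.prod_congr rfl fun i _ => ?_
  rw [mul_pow, ← map_pow PowerSeries.C, mul_assoc, ← map_mul PowerSeries.C]

end BernoulliCarlitz

/-! ### Calculus of reduction modulo P -/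

section ReducesTo

variable {F' : Type*} [Field F'] {Q : F'[X]}

lemma ReducesTo.of_polynomial (a : F'[X]) :
    ReducesTo Q (algebraMap F'[X] (RatFunc F') a) (AdjoinRoot.mk Q a) :=
  ⟨a, 1, by simp, by simp, by simp⟩

lemma ne_zero_of_isUnit_mk [Nontrivial (AdjoinRoot Q)] {b : F'[X]}
    (hb : IsUnit (AdjoinRoot.mk Q b)) : algebraMap F'[X] (RatFunc F') b ≠ 0 := by
  rw [Ne, map_eq_zero_iff _ (RatFunc.algebraMap_injective F')]
  rintro rfl
  simp at hb

lemma ReducesTo.add [Nontrivial (AdjoinRoot Q)] {x y : RatFunc F'} {c d : AdjoinRoot Q}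
    (hx : ReducesTo Q x c) (hy : ReducesTo Q y d) : ReducesTo Q (x + y) (c + d) := by
  obtain ⟨a, b, hb, rfl, h⟩ := hx
  obtain ⟨a', b', hb', rfl, h'⟩ := hy
  refine ⟨a * b' + b * a', b * b', by rw [map_mul]; exact hb.mul hb', ?_, ?_⟩
  · rw [div_add_div _ _ (ne_zero_of_isUnit_mk hb) (ne_zero_of_isUnit_mk hb')]
    simp only [map_add, map_mul]
  · rw [map_add, map_mul, map_mul, map_mul, h, h']
    ring

lemma ReducesTo.mul {x y : RatFunc F'} {c d : AdjoinRoot Q}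
    (hx : ReducesTo Q x c) (hy : ReducesTo Q y d) : ReducesTo Q (x * y) (c * d) := by
  obtain ⟨a, b, hb, rfl, h⟩ := hx
  obtain ⟨a', b', hb', rfl, h'⟩ := hy
  refine ⟨a * a', b * b', by rw [map_mul]; exact hb.mul hb', ?_, ?_⟩
  · rw [div_mul_div_comm, map_mul, map_mul]
  · rw [map_mul, map_mul, h, h']
    ring

lemma ReducesTo.zero : ReducesTo Q 0 0 := by simpa using ReducesTo.of_polynomial (Q := Q) 0

lemma ReducesTo.one : ReducesTo Q 1 1 := by simpa using ReducesTo.of_polynomial (Q := Q) 1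

lemma ReducesTo.pow {x : RatFunc F'} {c : AdjoinRoot Q} (h : ReducesTo Q x c) (n : ℕ) :
    ReducesTo Q (x ^ n) (c ^ n) := by
  induction n with
  | zero => simpa using ReducesTo.one
  | succ n ih => simpa [pow_succ] using ih.mul h

lemma ReducesTo.sum [Nontrivial (AdjoinRoot Q)] {ι : Type*} (t : Finset ι) {x : ι → RatFunc F'}
    {c : ι → AdjoinRoot Q} (h : ∀ i ∈ t, ReducesTo Q (x i) (c i)) :
    ReducesTo Q (∑ i ∈ t, x i) (∑ i ∈ t, c i) := by
  classical
  induction t using Finset.induction_on with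
  | empty => simpa using ReducesTo.zero
  | insert i t hi ih =>
    rw [Finset.sum_insert hi, Finset.sum_insert hi]
    exact (h i (Finset.mem_insert_self _ _)).add
      (ih fun k hk => h k (Finset.mem_insert_of_mem hk))

lemma ReducesTo.prod {ι : Type*} (t : Finset ι) {x : ι → RatFunc F'}
    {c : ι → AdjoinRoot Q} (h : ∀ i ∈ t, ReducesTo Q (x i) (c i)) :
    ReducesTo Q (∏ i ∈ t, x i) (∏ i ∈ t, c i) := by
  classical
  induction t using Finset.induction_on with
  | empty => simpa using ReducesTo.one
  | insert i t hi ih =>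
    rw [Finset.prod_insert hi, Finset.prod_insert hi]
    exact (h i (Finset.mem_insert_self _ _)).mul
      (ih fun k hk => h k (Finset.mem_insert_of_mem hk))

variable {F : Type*} [Field F] [Algebra F F'] {P : F[X]}

lemma residueMap_mk (a : F[X]) : residueMap F' P (AdjoinRoot.mk P a) =
    AdjoinRoot.mk (P.map (algebraMap F F')) (a.map (algebraMap F F')) := by
  simp only [residueMap, AdjoinRoot.map, AdjoinRoot.lift_mk, ← eval₂_map]
  exact AdjoinRoot.aeval_eq _

lemma ReducesTo.incl (a : F[X]) : ReducesTo (P.map (algebraMap F F')) (incl F F' a)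
    (residueMap F' P (AdjoinRoot.mk P a)) := by
  rw [residueMap_mk]
  exact ReducesTo.of_polynomial _

lemma ReducesTo.inv_incl [Fact (Irreducible P)] {a : F[X]} (ha : ¬ P ∣ a) :
    ReducesTo (P.map (algebraMap F F')) (Carlitz.incl F F' a)⁻¹
      (residueMap F' P (AdjoinRoot.mk P a)⁻¹) := by
  have h0 : AdjoinRoot.mk P a ≠ 0 := by rwa [Ne, AdjoinRoot.mk_eq_zero]
  refine ⟨1, a.map (algebraMap F F'), ?_, ?_, ?_⟩
  · rw [← residueMap_mk]
    exact h0.isUnit.map _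
  · rw [map_one, one_div]
    rfl
  · rw [← residueMap_mk, ← map_mul, mul_inv_cancel₀ h0, map_one, map_one]

end ReducesTo

section Inclusion

variable {F F' : Type*} [Field F] [Field F'] [Algebra F F']

lemma incl_C (a : F) : incl F F' (C a) = RatFunc.C (algebraMap F F' a) := by
  simp [incl, RatFunc.algebraMap_C]

lemma incl_X : incl F F' X = RatFunc.X := by simp [incl, RatFunc.algebraMap_X]

end Inclusion

/-! ### From poly-Bernoulli–Carlitz numbers to finite zeta values -/

section ZetaValues

open Classical in
/-- The strictly decreasing `r`-tuples of natural numbers less than `N`. -/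
def decr (r N : ℕ) : Finset (Fin r → ℕ) :=
  (Fintype.piFinset fun _ : Fin r => Finset.range N).filter StrictAnti

lemma mem_decr {r N : ℕ} {d : Fin r → ℕ} : d ∈ decr r N ↔ (∀ i, d i < N) ∧ StrictAnti d := by
  simp [decr]

variable {F : Type*} (F' : Type*) [Field F] [Fintype F] [Field F'] [Algebra F F']

/-- The product of the `ε_i ^ d_i S_{d_i}(s_i)`. -/
def zetaTerm {r : ℕ} (s : Fin r → ℕ) (ε : Fin r → Fˣ) (d : Fin r → ℕ) : RatFunc F' :=
  ∏ i, incl F F' (C (ε i : F)) ^ d i * powerSum (incl F F') (d i) (s i)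

lemma sum_zetaTerm {r : ℕ} (s : Fin r → ℕ) (ε : Fin r → Fˣ) (N : ℕ) :
    ∑ d ∈ decr r N, zetaTerm F' s ε d = ∑ a ∈ (indexSet_finite (F := F) r N).toFinset,
      ∏ i, incl F F' (C (ε i : F)) ^ (a i).natDegree * (incl F F' (a i) ^ s i)⁻¹ := by
  classical
  rw [← Finset.sum_fiberwise_of_maps_to (t := decr r N)
    (g := fun (a : Fin r → F[X]) i => (a i).natDegree)]
  · refine Finset.sum_congr rfl fun d hd => ?_
    have hset : ((indexSet_finite (F := F) r N).toFinset.filter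
        fun a => (fun i => (a i).natDegree) = d) =
        Fintype.piFinset fun i => monics F (d i) := by
      ext a
      simp only [Finset.mem_filter, Set.Finite.mem_toFinset, Fintype.mem_piFinset, mem_monics,
        indexSet, Set.mem_ofPred_eq]
      constructor
      · rintro ⟨h, rfl⟩ i
        exact ⟨h.1 i, rfl⟩
      · intro h
        have hda : (fun i => (a i).natDegree) = d := funext fun i => (h i).2
        refine ⟨⟨fun i => (h i).1, fun i => ?_, ?_⟩, hda⟩
        · rw [(h i).2]
          exact (mem_decr.1 hd).1 i
        · rw [hda]
          exact (mem_decr.1 hd).2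
    simp only [zetaTerm, powerSum, Finset.mul_sum]
    rw [hset, Finset.prod_univ_sum]
    refine Finset.sum_congr rfl fun a ha => Finset.prod_congr rfl fun i _ => ?_
    rw [(mem_monics.1 (Fintype.mem_piFinset.1 ha i)).2]
  · intro a ha
    have h : a ∈ indexSet F r N := by simpa using ha
    exact mem_decr.2 h.2

/-- The truncated zeta value in `k'` is a sum over tuples of monic polynomials, each invertible
modulo P, and reduces term by term. -/
lemma reducesTo_sum_zetaTerm {r : ℕ} (s : Fin r → ℕ) (ε : Fin r → Fˣ) (P : F[X])
    [hirr : Fact (Irreducible P)] :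
    ReducesTo (P.map (algebraMap F F')) (∑ d ∈ decr r P.natDegree, zetaTerm F' s ε d)
      (residueMap F' P (altFMZV (fun i => (s i : ℤ)) ε P)) := by
  have hdeg : (P.map (algebraMap F F')).degree ≠ 0 := by
    rw [degree_map]
    exact (degree_pos_of_irreducible hirr.out).ne'
  have : Nontrivial (AdjoinRoot (P.map (algebraMap F F'))) := AdjoinRoot.nontrivial _ hdeg
  rw [sum_zetaTerm, altFMZV, map_sum]
  refine ReducesTo.sum _ fun a ha => ?_
  rw [map_prod]
  refine ReducesTo.prod _ fun i _ => ?_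
  have ha' : a ∈ indexSet F r P.natDegree := by simpa using ha
  rw [div_eq_mul_inv, zpow_natCast, ← inv_pow, ← inv_pow, map_mul, map_pow, map_pow]
  refine ((ReducesTo.incl _).pow _).mul ((ReducesTo.inv_incl fun h => ?_).pow _)
  -- P cannot divide a nonzero polynomial of smaller degree.
  exact absurd (natDegree_le_of_dvd h (ha'.1 i).ne_zero) (not_le.2 (ha'.2.1 i))

lemma zetaTerm_append {m r : ℕ} (s : Fin r → ℕ) (ε : Fin r → Fˣ) (c : Fin m → ℕ)
    (e : Fin r → ℕ) :
    zetaTerm F' (Fin.append (fun _ : Fin m => 1) s) (Fin.append (fun _ : Fin m => 1) ε)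
      (Fin.append c e) = (∏ i, (incl F F' (L F (c i)))⁻¹) * zetaTerm F' s ε e := by
  simp only [zetaTerm, Fin.prod_univ_add, Fin.append_left, Fin.append_right,
    powerSum_one (incl_injective F F'), Units.val_one, map_one, one_pow, one_mul]

variable {F'}

lemma pow_card_pow_eq {γ : F'} {ε : F} (h : γ ^ (Fintype.card F - 1) = algebraMap F F' ε) (d : ℕ) :
    γ ^ Fintype.card F ^ d = γ * algebraMap F F' ε ^ d := by
  induction d with
  | zero => simp
  | succ d ih =>
    have hγ : γ ^ Fintype.card F = γ * algebraMap F F' ε := by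
      rw [← h, ← pow_succ', Nat.sub_add_cancel Fintype.card_pos]
    rw [pow_succ, pow_mul, ih, mul_pow, hγ, ← map_pow, ← map_pow, FiniteField.pow_card, map_pow]
    ring

/-- A term of the multiple polylogarithm that defines `BC^{s,γ,j}`. -/
def polylogTerm {r : ℕ} (F : Type*) [Field F] [Fintype F] [Algebra F F'] (s : Fin r → ℕ)
    (γ : Fin r → F') (j e : Fin r → ℕ) : RatFunc F' :=
  ∏ i, (RatFunc.C (γ i) * incl F F' (u F (s i) (j i))) ^ Fintype.card F ^ e i *
    (incl F F' (L F (e i)) ^ s i)⁻¹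

/-- The sum over the box `J` factors into one sum per slot; in each, the interpolation formula
produces L^s, which cancels the denominator, and γ^(q^e) supplies ε^e. -/
lemma sum_polylogTerm {r : ℕ} {s : Fin r → ℕ} (hs : ∀ i, 1 ≤ s i) {ε : Fin r → Fˣ}
    {γ : Fin r → F'} (hγ : ∀ i, γ i ^ (Fintype.card F - 1) = algebraMap F F' (ε i))
    (e : Fin r → ℕ) :
    ∑ j ∈ J F s, RatFunc.X ^ (∑ i, j i) * polylogTerm F s γ j e =
      (∏ i, RatFunc.C (γ i) * incl F F' (Gamma F (s i))) * zetaTerm F' s ε e := by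
  have h1 (i : Fin r) : ∑ j ∈ Finset.range ((H F (s i - 1)).natDegree + 1),
      RatFunc.X ^ j * ((RatFunc.C (γ i) * incl F F' (u F (s i) j)) ^ Fintype.card F ^ e i *
        (incl F F' (L F (e i)) ^ s i)⁻¹) =
      RatFunc.C (γ i) * incl F F' (Gamma F (s i)) *
        (incl F F' (C (ε i : F)) ^ e i * powerSum (incl F F') (e i) (s i)) := by
    have hL : incl F F' (L F (e i)) ^ s i ≠ 0 :=
      pow_ne_zero _ ((map_ne_zero_iff _ (incl_injective F F')).2 (L_ne_zero _))
    have h2 := sum_u_pow (incl_injective F F') (e i) (hs i)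
    rw [incl_X] at h2
    calc _ = RatFunc.C (γ i ^ Fintype.card F ^ e i) * (incl F F' (L F (e i)) ^ s i)⁻¹ *
          ∑ j ∈ Finset.range ((H F (s i - 1)).natDegree + 1),
            incl F F' (u F (s i) j) ^ Fintype.card F ^ e i * RatFunc.X ^ j := by
          rw [Finset.mul_sum]
          refine Finset.sum_congr rfl fun j _ => ?_
          rw [mul_pow, map_pow]
          ring
      _ = _ := by
          rw [h2, pow_card_pow_eq (hγ i), incl_C, map_mul, map_pow]
          field_simp
  rw [zetaTerm, ← Finset.prod_mul_distrib, ← Finset.prod_congr rfl fun i _ => h1 i,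
    Finset.prod_univ_sum, J]
  refine Finset.sum_congr rfl fun j _ => ?_
  rw [Finset.prod_mul_distrib, Finset.prod_pow_eq_pow_sum, polylogTerm]

/-- Both numbers carry the factor Π(q^d - 1), and L_d BC_(q^d - 1) is equal to it. As d < N bounds
every entry of a tuple starting at d, restricting to `decr r N` loses nothing. -/
lemma altBC_div {r : ℕ} (i₀ : Fin r) (hi₀ : i₀.val = 0) (s : Fin r → ℕ) (γ : Fin r → F')
    (j : Fin r → ℕ) {d N : ℕ} (hd : d < N) :
    altBC F s γ j (Fintype.card F ^ d - 1) /
      (incl F F' (L F d) * BC F F' (Fintype.card F ^ d - 1)) =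
      ∑ e ∈ decr r N with e i₀ = d, polylogTerm F s γ j e := by
  have hf : incl F F' (factorial F (Fintype.card F ^ d - 1)) ≠ 0 :=
    (map_ne_zero_iff _ (incl_injective F F')).2 (factorial_ne_zero _)
  have hL : incl F F' (L F d) ≠ 0 := (map_ne_zero_iff _ (incl_injective F F')).2 (L_ne_zero _)
  rw [altBC_pow_sub_one i₀ hi₀, BC_pow_sub_one, mul_left_comm, mul_inv_cancel₀ hL, mul_one,
    mul_div_cancel_left₀ _ hf]
  have h1 : ∑ᶠ e : {e : Fin r → ℕ // StrictAnti e}, (if e.1 i₀ = d then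
        ∏ i, (RatFunc.C (γ i) * incl F F' (u F (s i) (j i))) ^ Fintype.card F ^ e.1 i *
          (incl F F' (L F (e.1 i)) ^ s i)⁻¹ else 0) =
      ∑ᶠ e ∈ {e : Fin r → ℕ | StrictAnti e},
        if e i₀ = d then polylogTerm F s γ j e else 0 :=
    finsum_set_coe_eq_finsum_mem (f := fun e : Fin r → ℕ => if e i₀ = d then polylogTerm F s γ j e else 0)
      {e : Fin r → ℕ | StrictAnti e}
  rw [h1, Finset.sum_filter]
  refine finsum_mem_eq_sum_of_inter_support_eq _ ?_
  ext e
  simp only [Set.mem_inter_iff, Set.mem_ofPred_eq, Function.mem_support, Finset.mem_coe, mem_decr]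
  constructor
  · rintro ⟨he, h⟩
    refine ⟨⟨fun i => ?_, he⟩, h⟩
    have h2 : e i₀ = d := by by_contra h3; exact h (if_neg h3)
    have h4 : i₀ ≤ i := by rw [Fin.le_def]; omega
    exact (he.antitone h4).trans_lt (h2 ▸ hd)
  · rintro ⟨he, h⟩
    exact ⟨he.2, h⟩

/-- Accounts for the lower limit r - 1 in the theorem: no strictly decreasing tuple of length r
starts lower. -/
lemma sub_one_le_of_strictAnti {r : ℕ} (i₀ : Fin r) (hi₀ : i₀.val = 0) {e : Fin r → ℕ}
    (he : StrictAnti e) : r - 1 ≤ e i₀ := by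
  have h : ∀ k (hk : k < r), e ⟨k, hk⟩ + k ≤ e i₀ := by
    intro k
    induction k with
    | zero => intro hk; rw [show (⟨0, hk⟩ : Fin r) = i₀ from Fin.ext hi₀.symm]; simp
    | succ k ih =>
      intro hk
      have h1 := ih (by omega)
      have h2 : e ⟨k + 1, hk⟩ < e ⟨k, by omega⟩ := he (Fin.lt_def.2 (Nat.lt_succ_self k))
      omega
  have := h (r - 1) (by have := i₀.2; omega)
  omega

/-- A strictly decreasing tuple of length `m + r` consists of one of length `m + 1` and one of
length `r` which share the entry at place `m`. -/
lemma sum_decr_append {M : Type*} [AddCommMonoid M] {m r N : ℕ} (i₀ : Fin r) (hi₀ : i₀.val = 0)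
    (f : (Fin m → ℕ) → (Fin r → ℕ) → M) :
    ∑ d ∈ (Fintype.piFinset fun _ : Fin (m + 1) => Finset.Icc (r - 1) (N - 1)) with
        ∀ i k, i < k → d k < d i,
      ∑ e ∈ decr r N with e i₀ = d (Fin.last m), f (fun i => d i.castSucc) e =
    ∑ D ∈ decr (m + r) N, f (fun i => D (Fin.castAdd r i)) fun i => D (Fin.natAdd m i) := by
  rw [Finset.sum_sigma']
  have hr : 1 ≤ r := by have := i₀.2; omega
  -- The forward map drops the last entry of d, which e repeats as its first; the inverse reads off
  -- the first m + 1 and the last r entries, overlapping at place m.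
  refine Finset.sum_bij' (fun x _ => Fin.append (fun i => x.1 i.castSucc) x.2)
    (fun D _ => ⟨fun i => D (Fin.castLE (by omega) i), fun i => D (Fin.natAdd m i)⟩)
    ?_ ?_ ?_ ?_ ?_
  · rintro ⟨d, e⟩ h
    simp only [Finset.mem_sigma, Finset.mem_filter, Fintype.mem_piFinset, Finset.mem_Icc,
      mem_decr] at h
    obtain ⟨⟨h1, h2⟩, ⟨h3, h4⟩, h5⟩ := h
    -- The bound on e forces N > 0, without which the truncated `N - 1` would allow d = N = 0.
    have hN : ∀ i, d i < N := fun i => by have := h1 i; have := h3 i₀; omega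
    refine mem_decr.2 ⟨fun i => ?_, ?_⟩
    · induction i using Fin.addCases with
      | left i => simpa using hN _
      | right i => simpa using h3 i
    · intro a b hab
      induction a using Fin.addCases with
      | left a =>
        induction b using Fin.addCases with
        | left b =>
          simp only [Fin.append_left]
          exact h2 _ _ (by simp only [Fin.lt_def, Fin.val_castAdd, Fin.val_castSucc] at hab ⊢; omega)
        | right b =>
          simp only [Fin.append_left, Fin.append_right]
          have h6 : i₀ ≤ b := by rw [Fin.le_def]; omega
          exact (h5 ▸ h4.antitone h6).trans_lt (h2 _ _ (Fin.castSucc_lt_last a))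
      | right a =>
        induction b using Fin.addCases with
        | left b =>
          simp only [Fin.lt_def, Fin.val_natAdd, Fin.val_castAdd] at hab
          omega
        | right b =>
          simp only [Fin.append_right]
          exact h4 (by simp only [Fin.lt_def, Fin.val_natAdd] at hab ⊢; omega)
  · intro D hD
    obtain ⟨h1, h2⟩ := mem_decr.1 hD
    have h3 : StrictAnti fun i : Fin r => D (Fin.natAdd m i) := fun a b hab =>
      h2 (by simp only [Fin.lt_def, Fin.val_natAdd] at hab ⊢; omega)
    have h4 := sub_one_le_of_strictAnti i₀ hi₀ h3
    simp only [Finset.mem_sigma, Finset.mem_filter, Fintype.mem_piFinset, Finset.mem_Icc,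
      mem_decr]
    refine ⟨⟨fun i => ⟨?_, ?_⟩, fun i k hik => h2 (by simp only [Fin.lt_def, Fin.val_castLE] at hik ⊢; omega)⟩,
      ⟨fun i => h1 _, h3⟩, ?_⟩
    · refine h4.trans (h2.antitone ?_)
      simp only [Fin.le_def, Fin.val_natAdd, Fin.val_castLE]
      omega
    · have := h1 (Fin.castLE (by omega) i)
      omega
    · congr 1
      ext
      simp [hi₀]
  · rintro ⟨d, e⟩ h
    simp only [Finset.mem_sigma, Finset.mem_filter, mem_decr] at h
    have hd : (fun i : Fin (m + 1) => Fin.append (fun i : Fin m => d i.castSucc) e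
        (Fin.castLE (by omega) i)) = d := by
      funext i
      induction i using Fin.lastCases with
      | last =>
        have h1 : (Fin.castLE (by omega) (Fin.last m) : Fin (m + r)) = Fin.natAdd m i₀ := by
          ext
          simp [hi₀]
        rw [h1, Fin.append_right, h.2.2]
      | cast i =>
        exact Fin.append_left (fun i : Fin m => d i.castSucc) e i
    simp only [hd, Fin.append_right]
  · intro D hD
    funext i
    induction i using Fin.addCases with
    | left i => simp only [Fin.append_left]; rfl
    | right i => simp only [Fin.append_right]
  · rintro ⟨d, e⟩ h
    simp only [Fin.append_left, Fin.append_right]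

lemma sum_altBC {r : ℕ} (i₀ : Fin r) (hi₀ : i₀.val = 0) {s : Fin r → ℕ} (hs : ∀ i, 1 ≤ s i)
    {ε : Fin r → Fˣ} {γ : Fin r → F'}
    (hγ : ∀ i, γ i ^ (Fintype.card F - 1) = algebraMap F F' (ε i)) {d N : ℕ} (hd : d < N) :
    ∑ j ∈ J F s, RatFunc.X ^ (∑ i, j i) * (altBC F s γ j (Fintype.card F ^ d - 1) /
      (incl F F' (L F d) * BC F F' (Fintype.card F ^ d - 1))) =
    (∏ i, RatFunc.C (γ i) * incl F F' (Gamma F (s i))) *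
      ∑ e ∈ decr r N with e i₀ = d, zetaTerm F' s ε e := by
  simp only [altBC_div i₀ hi₀ s γ _ hd, Finset.mul_sum]
  rw [Finset.sum_comm]
  exact Finset.sum_congr rfl fun e _ => sum_polylogTerm hs hγ e

lemma prod_C_mul_Gamma_ne_zero {r : ℕ} (s : Fin r → ℕ) {ε : Fin r → Fˣ} {γ : Fin r → F'}
    (hγ : ∀ i, γ i ^ (Fintype.card F - 1) = algebraMap F F' (ε i)) :
    ∏ i, RatFunc.C (γ i) * incl F F' (Gamma F (s i)) ≠ 0 := by
  refine Finset.prod_ne_zero_iff.2 fun i _ => mul_ne_zero ?_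
    ((map_ne_zero_iff _ (incl_injective F F')).2 (factorial_ne_zero _))
  rw [_root_.map_ne_zero]
  intro h
  have h1 := hγ i
  have h2 : Fintype.card F - 1 ≠ 0 := by
    have := Fintype.one_lt_card (α := F)
    omega
  rw [h, zero_pow h2, eq_comm, map_eq_zero] at h1
  exact (ε i).ne_zero h1

/-- The sum over `d_0 > ⋯ > d_m` of the quotients of Bernoulli–Carlitz numbers in the main theorem,
as a sum over tuples of degrees of length `m + r`. -/
lemma sum_altBC_eq_sum_zetaTerm {r : ℕ} (i₀ : Fin r) (hi₀ : i₀.val = 0) {s : Fin r → ℕ}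
    (hs : ∀ i, 1 ≤ s i) {ε : Fin r → Fˣ} {γ : Fin r → F'}
    (hγ : ∀ i, γ i ^ (Fintype.card F - 1) = algebraMap F F' (ε i)) {N : ℕ} (hN : 0 < N) (m : ℕ) :
    (∏ i, RatFunc.C (γ i) * incl F F' (Gamma F (s i)))⁻¹ *
      ∑ j ∈ J F s, RatFunc.X ^ (∑ i, j i) *
        ∑ d ∈ (Fintype.piFinset fun _ : Fin (m + 1) => Finset.Icc (r - 1) (N - 1)) with
            ∀ i k, i < k → d k < d i,
          altBC F s γ j (Fintype.card F ^ d (Fin.last m) - 1) /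
            ((∏ i, incl F F' (L F (d i))) * BC F F' (Fintype.card F ^ d (Fin.last m) - 1)) =
    ∑ D ∈ decr (m + r) N, zetaTerm F' (Fin.append (fun _ : Fin m => 1) s)
      (Fin.append (fun _ : Fin m => 1) ε) D := by
  -- The last L stays with the Bernoulli–Carlitz quotient, to be absorbed by `sum_altBC`; the other
  -- m become the power sums S(1) of the leading ones.
  have hterm (d : Fin (m + 1) → ℕ) (j : Fin r → ℕ) :
      altBC F s γ j (Fintype.card F ^ d (Fin.last m) - 1) /
        ((∏ i, incl F F' (L F (d i))) * BC F F' (Fintype.card F ^ d (Fin.last m) - 1)) =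
      (∏ i : Fin m, (incl F F' (L F (d i.castSucc)))⁻¹) *
        (altBC F s γ j (Fintype.card F ^ d (Fin.last m) - 1) / (incl F F' (L F (d (Fin.last m))) *
          BC F F' (Fintype.card F ^ d (Fin.last m) - 1))) := by
    rw [Fin.prod_univ_castSucc, mul_assoc, Finset.prod_inv_distrib, div_eq_mul_inv,
      div_eq_mul_inv, mul_inv]
    ring
  have happ : ∀ D ∈ decr (m + r) N, zetaTerm F' (Fin.append (fun _ : Fin m => 1) s)
      (Fin.append (fun _ : Fin m => 1) ε) D =
        (∏ i, (incl F F' (L F (D (Fin.castAdd r i))))⁻¹) *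
          zetaTerm F' s ε fun i => D (Fin.natAdd m i) := by
    intro D _
    rw [← zetaTerm_append, Fin.append_castAdd_natAdd]
  rw [Finset.sum_congr rfl happ, ← sum_decr_append i₀ hi₀
    (fun c e => (∏ i, (incl F F' (L F (c i)))⁻¹) * zetaTerm F' s ε e),
    inv_mul_eq_iff_eq_mul₀ (prod_C_mul_Gamma_ne_zero s hγ)]
  simp only [hterm]
  simp only [Finset.mul_sum]
  rw [Finset.sum_comm]
  refine Finset.sum_congr rfl fun d hd => ?_
  have hdN : d (Fin.last m) < N := by
    have := (Finset.mem_Icc.1 (Fintype.mem_piFinset.1 (Finset.mem_filter.1 hd).1 (Fin.last m))).2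
    omega
  have h := sum_altBC i₀ hi₀ hs hγ hdN
  rw [Finset.sum_congr rfl fun j _ => mul_left_comm _ _ _, ← Finset.mul_sum, h, Finset.mul_sum,
    Finset.mul_sum]
  exact Finset.sum_congr rfl fun e _ => mul_left_comm _ _ _

lemma sum_Icc_altBC_eq_sum_zetaTerm {r : ℕ} (i₀ : Fin r) (hi₀ : i₀.val = 0) {s : Fin r → ℕ}
    (hs : ∀ i, 1 ≤ s i) {ε : Fin r → Fˣ} {γ : Fin r → F'}
    (hγ : ∀ i, γ i ^ (Fintype.card F - 1) = algebraMap F F' (ε i)) {N : ℕ} (hN : 0 < N) :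
    (∏ i, RatFunc.C (γ i) * incl F F' (Gamma F (s i)))⁻¹ *
      ∑ j ∈ J F s, RatFunc.X ^ (∑ i, j i) * ∑ d ∈ Finset.Icc (r - 1) (N - 1),
        altBC F s γ j (Fintype.card F ^ d - 1) /
          (incl F F' (L F d) * BC F F' (Fintype.card F ^ d - 1)) =
    ∑ e ∈ decr r N, zetaTerm F' s ε e := by
  rw [inv_mul_eq_iff_eq_mul₀ (prod_C_mul_Gamma_ne_zero s hγ),
    ← Finset.sum_fiberwise_of_maps_to (s := decr r N) (t := Finset.Icc (r - 1) (N - 1))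
      (g := fun e => e i₀),
    Finset.mul_sum]
  · simp only [Finset.mul_sum (Finset.Icc (r - 1) (N - 1)) _ _]
    rw [Finset.sum_comm]
    refine Finset.sum_congr rfl fun d hd => sum_altBC i₀ hi₀ hs hγ ?_
    have := (Finset.mem_Icc.1 hd).2
    omega
  · intro e he
    have h := mem_decr.1 he
    have := h.1 i₀
    exact Finset.mem_Icc.2 ⟨sub_one_le_of_strictAnti i₀ hi₀ h.2, by omega⟩

end ZetaValues

end Carlitz
end

/-! ### The main theorem -/

theorem mainTheorem1 {F F' : Type*} [Field F] [Fintype F] [Field F'] [Fintype F'] [Algebra F F']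
    (hF' : Fintype.card F' = Fintype.card F ^ (Fintype.card F - 1))
    {r : ℕ} (hr : 1 ≤ r) (s : Fin r → ℕ) (hs : ∀ i, 1 ≤ s i)
    (ε : Fin r → Fˣ) (γ : Fin r → F')
    (hγ : ∀ i, γ i ^ (Fintype.card F - 1) = algebraMap F F' (ε i))
    (P : F[X]) [Fact (Irreducible P)] (hP : P.Monic) (hPΓ : ∀ i, ¬ P ∣ Carlitz.Gamma F (s i)) :
    Carlitz.ReducesTo (P.map (algebraMap F F'))
      ((∏ i, RatFunc.C (γ i) * Carlitz.incl F F' (Carlitz.Gamma F (s i)))⁻¹ *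
        ∑ j ∈ Carlitz.J F s, RatFunc.X ^ (∑ i, j i) *
          ∑ d ∈ Finset.Icc (r - 1) (P.natDegree - 1),
            Carlitz.altBC F s γ j (Fintype.card F ^ d - 1) /
              (Carlitz.incl F F' (Carlitz.L F d) * Carlitz.BC F F' (Fintype.card F ^ d - 1)))
      (Carlitz.residueMap F' P (Carlitz.altFMZV (fun i => (s i : ℤ)) ε P)) ∧
    ∀ r' : ℕ,
      Carlitz.ReducesTo (P.map (algebraMap F F'))
        ((∏ i, RatFunc.C (γ i) * Carlitz.incl F F' (Carlitz.Gamma F (s i)))⁻¹ *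
          ∑ j ∈ Carlitz.J F s, RatFunc.X ^ (∑ i, j i) *
            ∑ d ∈ (Fintype.piFinset fun _ : Fin (r' + 1) =>
                Finset.Icc (r - 1) (P.natDegree - 1)) with ∀ i k, i < k → d k < d i,
              Carlitz.altBC F s γ j (Fintype.card F ^ d (Fin.last r') - 1) /
                ((∏ i, Carlitz.incl F F' (Carlitz.L F (d i))) *
                  Carlitz.BC F F' (Fintype.card F ^ d (Fin.last r') - 1)))
        (Carlitz.residueMap F' P
          (Carlitz.altFMZV (Fin.append (fun _ : Fin r' => (1 : ℤ)) fun i => (s i : ℤ))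
            (Fin.append (fun _ : Fin r' => (1 : Fˣ)) ε) P)) := by
  -- Positivity makes d ≤ deg P - 1, with truncated subtraction, equivalent to d < deg P.
  have hN : 0 < P.natDegree := (Fact.out : Irreducible P).natDegree_pos
  refine ⟨?_, fun r' => ?_⟩
  · rw [Carlitz.sum_Icc_altBC_eq_sum_zetaTerm ⟨0, hr⟩ rfl hs hγ hN]
    exact Carlitz.reducesTo_sum_zetaTerm F' s ε P
  · rw [Carlitz.sum_altBC_eq_sum_zetaTerm ⟨0, hr⟩ rfl hs hγ hN r']
    have happ : (Fin.append (fun _ : Fin r' => (1 : ℤ)) fun i => (s i : ℤ)) =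
        fun i => ((Fin.append (fun _ : Fin r' => 1) s i : ℕ) : ℤ) := by
      funext i
      induction i using Fin.addCases <;> simp
    rw [happ]
    exact Carlitz.reducesTo_sum_zetaTerm F' _ _ P
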